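/- Let $F$ be a field and let $\Gamma_1$ be the directed graph with two vertices $v_1,v_2$, a loop $c$ at $v_1$ and one edge $d$ from $v_1$ to the sink $v_2$. The algebraic Toeplitz algebra $L(\Gamma_1)$ is the Leavitt path algebra of $\Gamma_1$: the $F$-algebra with generators $v_1,v_2,c,d,c^*,d^*$ and relations $v_iv_j=\delta_{ij}v_i$; $s(e)e=e\,r(e)=e$, $r(e)e^*=e^*s(e)=e^*$ and $e^*f=\delta_{e,f}\,r(e)$ for edges $e,f\in\{c,d\}$ with source $s$ and range $r$; $v_1=cc^*+dd^*$. Its unit is $v_1+v_2$. Let $*$ be the standard involution, $v_i\mapsto v_i$, $e\mapsto e^*$, $e^*\mapsto e$, and let $I_0$ be the ideal generated by $v_2$. Let $E$ be the algebra of all linear transformations of a vector space with basis $e_0,e_1,e_2,\dots$, that is, of infinite matrices with finitely many nonzero entries in each column, with matrix units $e_{ij}$ ($i,j\ge 0$); let $M_\infty(F)\subset E$ consist of the matrices with finitely many nonzero entries, let $GL_\infty(F)$ be the group of invertible matrices in $1+M_\infty(F)$, and for $\alpha\in F^*$ put $\pi(\alpha)=\mathrm{diag}(1,\alpha,\alpha^2,\dots)$.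 Automorphisms and involutions are $F$-linear. (0) The assignment $v_2\mapsto e_{00}$, $v_1\mapsto 1-e_{00}$, $d\mapsto e_{10}$, $d^*\mapsto e_{01}$, $c\mapsto\sum_{i\ge1}e_{i+1,i}$, $c^*\mapsto\sum_{i\ge1}e_{i,i+1}$ extends to an embedding $\rho:L(\Gamma_1)\to E$ of unital algebras, and $c\mapsto t$, $c^*\mapsto t^{-1}$, $v_1\mapsto 1$, $v_2,d,d^*\mapsto 0$ extends to a surjective homomorphism $L(\Gamma_1)\to F[t^{-1},t]$ with kernel $I_0$; so $L(\Gamma_1)/I_0\cong F[t^{-1},t]$. (1) $\mathrm{Aut}(L(\Gamma_1))\cong F^*\ltimes GL_\infty(F)$, the semidirect product in which $\alpha\in F^*$ acts on $GL_\infty(F)$ by $g\mapsto\pi(\alpha)g\pi(\alpha)^{-1}$. The isomorphism can be chosen so that $(g,\alpha)$ corresponds to the automorphism $\varphi$ with $\rho(\varphi(x))=(g\pi(\alpha))\,\rho(x)\,(g\pi(\alpha))^{-1}$ for all $x\in L(\Gamma_1)$. (2) Every automorphism of $L(\Gamma_1)$ induces on $L(\Gamma_1)/I_0\cong F[t^{-1},t]$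 an automorphism of the form $t\mapsto at$ with $a\in F^*$. (3) If an automorphism $\varphi$ of $L(\Gamma_1)$ induces the identity on $L(\Gamma_1)/I_0$, and $T\in E$ is invertible with $\rho(\varphi(x))=T^{-1}\rho(x)T$ for all $x\in L(\Gamma_1)$, then $T=\alpha\cdot 1+a$ with $\alpha\in F$, $\alpha\neq0$, and $a\in M_\infty(F)$. (4) If every element of $F$ is a square, then for every involution $\tau$ of $L(\Gamma_1)$ there is an automorphism $\varphi$ of $L(\Gamma_1)$ such that $\varphi(\tau(x))=\varphi(x)^*$ for all $x\in L(\Gamma_1)$; that is, up to isomorphism $*$ is the only involution on $L(\Gamma_1)$. -/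

import Mathlib

open scoped LaurentPolynomial

noncomputable section

/-! ### Leavitt path algebras of finite directed graphs -/

/-- A directed graph with vertex type `V` and edge type `E`: every edge has a source and a range. -/
structure DirGraph (V E : Type*) where
  /-- the source of an edge -/
  s : E → V
  /-- the range of an edge -/
  r : E → V

namespace Leavitt

/-- The generators `v` (for vertices), `e` and `e^*` (for edges). -/
inductive Gen (V E : Type*) where
  | vert (v : V) : Gen V E
  | edge (e : E) : Gen V E
  | ghost (e : E) : Gen V E

section
variable (F : Type*) [Field F] {V E : Type*} [Fintype V] [DecidableEq V] [Fintype E] [DecidableEq E]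

/-- The defining relations of the Leavitt path algebra, in the free unital algebra on the
generators. For a finite graph the algebra presented by the other relations (without
presupposing a unit) has the identity element `∑ v`; the relation `sum_vert` says that this
element is the unit. -/
inductive Rel (Γ : DirGraph V E) :
    FreeAlgebra F (Gen V E) → FreeAlgebra F (Gen V E) → Prop
  | vert_mul_vert (u v : V) :
      Rel Γ (FreeAlgebra.ι F (Gen.vert u) * FreeAlgebra.ι F (Gen.vert v))
        (if u = v then FreeAlgebra.ι F (Gen.vert u) else 0)
  | source_mul_edge (e : E) :
      Rel Γ (FreeAlgebra.ι F (Gen.vert (Γ.s e)) * FreeAlgebra.ι F (Gen.edge e))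
        (FreeAlgebra.ι F (Gen.edge e))
  | edge_mul_range (e : E) :
      Rel Γ (FreeAlgebra.ι F (Gen.edge e) * FreeAlgebra.ι F (Gen.vert (Γ.r e)))
        (FreeAlgebra.ι F (Gen.edge e))
  | range_mul_ghost (e : E) :
      Rel Γ (FreeAlgebra.ι F (Gen.vert (Γ.r e)) * FreeAlgebra.ι F (Gen.ghost e))
        (FreeAlgebra.ι F (Gen.ghost e))
  | ghost_mul_source (e : E) :
      Rel Γ (FreeAlgebra.ι F (Gen.ghost e) * FreeAlgebra.ι F (Gen.vert (Γ.s e)))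
        (FreeAlgebra.ι F (Gen.ghost e))
  | ghost_mul_edge (e f : E) :
      Rel Γ (FreeAlgebra.ι F (Gen.ghost e) * FreeAlgebra.ι F (Gen.edge f))
        (if e = f then FreeAlgebra.ι F (Gen.vert (Γ.r e)) else 0)
  | vert_eq_sum (v : V) (hv : ∃ e, Γ.s e = v) :
      Rel Γ (FreeAlgebra.ι F (Gen.vert v))
        (∑ e ∈ Finset.univ.filter (fun e => Γ.s e = v),
          FreeAlgebra.ι F (Gen.edge e) * FreeAlgebra.ι F (Gen.ghost e))
  | sum_vert :
      Rel Γ (∑ v, FreeAlgebra.ι F (Gen.vert v)) 1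

end

end Leavitt

/-- The Leavitt path algebra `L(Γ)` over `F` of a finite directed graph. -/
abbrev LeavittPathAlgebra (F : Type*) [Field F] {V E : Type*} [Fintype V] [DecidableEq V]
    [Fintype E] [DecidableEq E] (Γ : DirGraph V E) : Type _ :=
  RingQuot (Leavitt.Rel F Γ)

/-- An involution of an `F`-algebra: an `F`-linear anti-automorphism of order dividing two. -/
structure AlgInvolution (F A : Type*) [CommSemiring F] [Semiring A] [Algebra F A] extends
    A →ₗ[F] A where
  map_mul_rev : ∀ a b : A, toFun (a * b) = toFun b * toFun a
  apply_apply : ∀ a : A, toFun (toFun a) = a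

instance (F A : Type*) [CommSemiring F] [Semiring A] [Algebra F A] :
    CoeFun (AlgInvolution F A) (fun _ => A → A) :=
  ⟨fun τ => τ.toLinearMap⟩

namespace Leavitt

section
variable (F : Type*) [Field F] {V E : Type*} [Fintype V] [DecidableEq V] [Fintype E] [DecidableEq E]
  (Γ : DirGraph V E)

/-- The image of a generator in the Leavitt path algebra. -/
def gen (g : Gen V E) : LeavittPathAlgebra F Γ :=
  RingQuot.mkAlgHom F (Rel F Γ) (FreeAlgebra.ι F g)

/-- The values of the standard involution on generators: `v ↦ v`, `e ↦ e^*`, `e^* ↦ e`. -/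
def starGen : Gen V E → Gen V E
  | .vert v => .vert v
  | .edge e => .ghost e
  | .ghost e => .edge e

/-- The standard involution as a homomorphism to the opposite algebra. -/
def starHom : LeavittPathAlgebra F Γ →ₐ[F] (LeavittPathAlgebra F Γ)ᵐᵒᵖ :=
  RingQuot.liftAlgHom F ⟨FreeAlgebra.lift F fun g => MulOpposite.op (gen F Γ (starGen g)), by
    have key : ∀ {a b}, Rel F Γ a b →
        RingQuot.mkAlgHom F (Rel F Γ) a = RingQuot.mkAlgHom F (Rel F Γ) b :=
      fun h => RingQuot.mkAlgHom_rel F h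
    intro a b h
    apply MulOpposite.unop_injective
    cases h with
    | vert_mul_vert u v =>
      have := key (Rel.vert_mul_vert (F := F) (Γ := Γ) v u)
      by_cases huv : u = v
      · subst huv
        simpa [starGen, gen] using this
      · simpa [starGen, gen, huv, Ne.symm huv] using this
    | source_mul_edge e => simpa [starGen, gen] using key (Rel.ghost_mul_source (F := F) (Γ := Γ) e)
    | edge_mul_range e => simpa [starGen, gen] using key (Rel.range_mul_ghost (F := F) (Γ := Γ) e)
    | range_mul_ghost e => simpa [starGen, gen] using key (Rel.edge_mul_range (F := F) (Γ := Γ) e)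
    | ghost_mul_source e => simpa [starGen, gen] using key (Rel.source_mul_edge (F := F) (Γ := Γ) e)
    | ghost_mul_edge e f =>
      have := key (Rel.ghost_mul_edge (F := F) (Γ := Γ) f e)
      by_cases hef : e = f
      · subst hef
        simpa [starGen, gen] using this
      · simpa [starGen, gen, hef, Ne.symm hef] using this
    | vert_eq_sum v hv =>
      simpa [starGen, gen, Finset.unop_sum] using key (Rel.vert_eq_sum (F := F) (Γ := Γ) v hv)
    | sum_vert =>
      simpa [starGen, gen, Finset.unop_sum] using key (Rel.sum_vert (F := F) (Γ := Γ))⟩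

theorem starHom_gen (g : Gen V E) :
    starHom F Γ (gen F Γ g) = MulOpposite.op (gen F Γ (starGen g)) := by
  simp [starHom, gen, RingQuot.liftAlgHom_mkAlgHom_apply]

theorem starHom_starHom (a : LeavittPathAlgebra F Γ) :
    (starHom F Γ (starHom F Γ a).unop).unop = a := by
  have : ((AlgEquiv.opOp F (LeavittPathAlgebra F Γ)).symm.toAlgHom.comp
      ((AlgHom.op (starHom F Γ)).comp (starHom F Γ))) = AlgHom.id F _ := by
    apply RingQuot.ringQuot_ext'
    apply FreeAlgebra.hom_ext
    funext g
    have h1 := starHom_gen F Γ g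
    have h2 := starHom_gen F Γ (starGen g)
    have h3 : starGen (starGen g) = g := by cases g <;> rfl
    rw [h3] at h2
    simp only [gen] at h1 h2
    simp [h1, h2]
  exact DFunLike.congr_fun this a

/-- The standard involution `*` of a Leavitt path algebra: the one with
`v ↦ v`, `e ↦ e^*`, `e^* ↦ e`. -/
def stdInvolution : AlgInvolution F (LeavittPathAlgebra F Γ) where
  toFun a := (starHom F Γ a).unop
  map_add' a b := by simp
  map_smul' a b := by simp
  map_mul_rev a b := by simp
  apply_apply a := starHom_starHom F Γ a

end

end Leavitt

/-! ### The algebraic Toeplitz algebra -/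

namespace Toeplitz

open Leavitt

/-- The graph `Γ₁`: two vertices `0`, `1`, a loop (edge `0`) at the vertex `0`, and an edge
(edge `1`) from the vertex `0` to the sink `1`. -/
def graph : DirGraph (Fin 2) (Fin 2) where
  s := ![0, 0]
  r := ![0, 1]

theorem graph_s (e : Fin 2) : graph.s e = 0 := by
  fin_cases e <;> rfl

section
variable (F : Type*) [Field F]

/-- The algebraic Toeplitz algebra `L(Γ₁)`. -/
abbrev Alg : Type _ := LeavittPathAlgebra F graph

/-- The ideal `I₀` of `L(Γ₁)` generated by the sink. -/
def sinkIdeal : TwoSidedIdeal (Alg F) := TwoSidedIdeal.span {gen F graph (.vert 1)}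

/-- The values on generators of the projection of `L(Γ₁)` onto the Laurent polynomials. -/
def laurentGen : Gen (Fin 2) (Fin 2) → F[T;T⁻¹]
  | .vert 0 => 1
  | .vert 1 => 0
  | .edge 0 => LaurentPolynomial.T 1
  | .edge 1 => 0
  | .ghost 0 => LaurentPolynomial.T (-1)
  | .ghost 1 => 0

/-- The projection `L(Γ₁) → F[t⁻¹, t]` which sends the loop `c` to `t`, its conjugate `c^*` to
`t⁻¹`, and the sink to `0`. -/
def toLaurent : Alg F →ₐ[F] F[T;T⁻¹] :=
  RingQuot.liftAlgHom F ⟨FreeAlgebra.lift F (laurentGen F), by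
    have h1 : (LaurentPolynomial.T 1 : F[T;T⁻¹]) * LaurentPolynomial.T (-1) = 1 := by
      rw [← LaurentPolynomial.T_add]; simp
    have h2 : (LaurentPolynomial.T (-1) : F[T;T⁻¹]) * LaurentPolynomial.T 1 = 1 := by
      rw [← LaurentPolynomial.T_add]; simp
    intro a b h
    cases h with
    | vert_mul_vert u v => fin_cases u <;> fin_cases v <;> simp [laurentGen]
    | source_mul_edge e => fin_cases e <;> simp [laurentGen, graph]
    | edge_mul_range e => fin_cases e <;> simp [laurentGen, graph]
    | range_mul_ghost e => fin_cases e <;> simp [laurentGen, graph]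
    | ghost_mul_source e => fin_cases e <;> simp [laurentGen, graph]
    | ghost_mul_edge e f =>
      fin_cases e <;> fin_cases f <;> simp [laurentGen, graph, h2]
    | vert_eq_sum v hv =>
      fin_cases v
      · simp [laurentGen, graph_s, Fin.sum_univ_two, h1]
      · obtain ⟨e, he⟩ := hv
        fin_cases e <;> simp [graph] at he
    | sum_vert => simp [laurentGen, Fin.sum_univ_two]⟩

/-! ### Infinite matrices -/

/-- The algebra `E` of all linear transformations of the space with basis `e₀, e₁, e₂, …`, that is,
of the `ℕ × ℕ` matrices with finitely many nonzero entries in each column. -/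
abbrev ColFin : Type _ := Module.End F (ℕ →₀ F)

variable {F}

/-- The matrix entry of a linear transformation in row `i` and column `j`. -/
def entry (T : ColFin F) (i j : ℕ) : F := T (Finsupp.single j 1) i

/-- Membership in `M_∞(F)`: only finitely many entries are nonzero. -/
def IsFinitary (T : ColFin F) : Prop := {p : ℕ × ℕ | entry T p.1 p.2 ≠ 0}.Finite

/-- Columns being finite, a matrix is finitary when almost all columns vanish. -/
theorem isFinitary_iff (T : ColFin F) :
    IsFinitary T ↔ {j : ℕ | T (Finsupp.single j 1) ≠ 0}.Finite := by
  constructor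
  · intro h
    refine (h.image Prod.snd).subset ?_
    intro j hj
    obtain ⟨i, hi⟩ := Finsupp.ne_iff.mp hj
    exact ⟨(i, j), hi, rfl⟩
  · intro h
    refine (h.biUnion fun j _ =>
      ((T (Finsupp.single j 1)).support.finite_toSet.image fun i => (i, j))).subset ?_
    rintro ⟨i, j⟩ hij
    have hij' : T (Finsupp.single j 1) i ≠ 0 := hij
    simp only [Set.mem_iUnion]
    refine ⟨j, fun h0 => hij' (by rw [h0]; rfl), i, ?_, rfl⟩
    simpa using hij'

theorem IsFinitary.add {S T : ColFin F} (hS : IsFinitary S) (hT : IsFinitary T) :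
    IsFinitary (S + T) := by
  refine (hS.union hT).subset fun p hp => ?_
  by_contra h
  simp only [Set.mem_union, Set.mem_ofPred_eq, not_or, not_not] at h
  exact hp (show S _ _ + T _ _ = 0 by
    rw [show S (Finsupp.single p.2 1) p.1 = 0 from h.1,
      show T (Finsupp.single p.2 1) p.1 = 0 from h.2, add_zero])

theorem IsFinitary.mul_left {T : ColFin F} (S : ColFin F) (hT : IsFinitary T) :
    IsFinitary (S * T) := by
  rw [isFinitary_iff] at hT ⊢
  refine hT.subset fun j hj h0 => hj ?_
  simp [h0]

variable (F)

/-- The finitary general linear group `GL_∞(F)`: the invertible matrices in `1 + M_∞(F)`. -/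
def GLInf : Subgroup (ColFin F)ˣ where
  carrier := {T | ∃ a : ColFin F, IsFinitary a ∧ (T : ColFin F) = 1 + a}
  one_mem' := ⟨0, by simp [IsFinitary, entry], by simp⟩
  mul_mem' := by
    rintro S T ⟨a, ha, hS⟩ ⟨b, hb, hT⟩
    refine ⟨a + (S : ColFin F) * b, ha.add (hb.mul_left _), ?_⟩
    rw [Units.val_mul, hT, mul_add, mul_one, ← add_assoc, ← hS]
  inv_mem' := by
    rintro T ⟨a, ha, hT⟩
    refine ⟨((-1 : F) • ((T⁻¹ : (ColFin F)ˣ) : ColFin F)) * a, ha.mul_left _, ?_⟩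
    have h1 : ((T⁻¹ : (ColFin F)ˣ) : ColFin F) + ((T⁻¹ : (ColFin F)ˣ) : ColFin F) * a = 1 := by
      rw [← Units.inv_mul T, hT, mul_add, mul_one]
    have h2 : ∀ y : ColFin F, y + (-1 : F) • y = 0 := fun y => by
      rw [← one_smul F y, smul_smul, ← add_smul]; simp
    rw [smul_mul_assoc, ← h1, add_assoc, h2, add_zero]

/-- The matrix `diag(1, α, α², …)`. -/
def diagEnd (α : F) : ColFin F :=
  Finsupp.linearCombination F fun i : ℕ => Finsupp.single i (α ^ i)

theorem diagEnd_mul (α β : F) : diagEnd F (α * β) = diagEnd F α * diagEnd F β := by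
  refine Finsupp.lhom_ext' fun i => LinearMap.ext_ring ?_
  simp [diagEnd, mul_pow, mul_comm]

theorem diagEnd_one : diagEnd F 1 = 1 := by
  refine Finsupp.lhom_ext' fun i => LinearMap.ext_ring ?_
  simp [diagEnd]

/-- The embedding `π : F^* → E^*`, `π(α) = diag(1, α, α², …)`. -/
def diag : Fˣ →* (ColFin F)ˣ :=
  Units.map { toFun := diagEnd F, map_one' := diagEnd_one F, map_mul' := diagEnd_mul F }

theorem diag_conj_mem (α : Fˣ) (T : (ColFin F)ˣ) (hT : T ∈ GLInf F) :
    diag F α * T * (diag F α)⁻¹ ∈ GLInf F := by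
  obtain ⟨a, ha, hT⟩ := hT
  refine ⟨(diag F α : ColFin F) * (a * (((diag F α)⁻¹ : (ColFin F)ˣ) : ColFin F)),
    IsFinitary.mul_left _ ?_, ?_⟩
  · rw [isFinitary_iff] at ha ⊢
    refine ha.subset fun j hj h0 => hj ?_
    have h1 : (((diag F α)⁻¹ : (ColFin F)ˣ) : ColFin F) (Finsupp.single j 1)
        = (((α⁻¹ : Fˣ) : F) ^ j) • Finsupp.single j (1 : F) := by
      rw [← map_inv]
      simp [diag, diagEnd]
    rw [Module.End.mul_apply, h1, map_smul, h0, smul_zero]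
  · rw [Units.val_mul, Units.val_mul, hT, mul_add, mul_one, add_mul, Units.mul_inv, mul_assoc]

/-- The action of `F^*` on `GL_∞(F)`: `α` acts as `g ↦ π(α) g π(α)⁻¹`. -/
def diagAction : Fˣ →* MulAut (GLInf F) where
  toFun α :=
    { toFun := fun g => ⟨diag F α * g * (diag F α)⁻¹, diag_conj_mem F α g g.2⟩
      invFun := fun g => ⟨diag F α⁻¹ * g * (diag F α⁻¹)⁻¹, diag_conj_mem F α⁻¹ g g.2⟩
      left_inv := fun g => by ext1; simp [mul_assoc]
      right_inv := fun g => by ext1; simp [mul_assoc]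
      map_mul' := fun g h => by ext1; simp [mul_assoc] }
  map_one' := by ext1 g; ext1; simp
  map_mul' α β := by ext1 g; ext1; simp [mul_assoc]

/-! ### The embedding of the Toeplitz algebra into the infinite matrices -/

/-- The images of the basis vectors under the generators. The basis vectors `e₀, e₁, e₂, e₃, …`
stand for the paths `v, d, cd, ccd, …` that end at the sink `v`, where `c` is the loop and `d` the
other edge, and the algebra acts on them by left multiplication. -/
def matrixGenFun : Gen (Fin 2) (Fin 2) → ℕ → (ℕ →₀ F)
  | .vert 0, 0 => 0
  | .vert 0, n + 1 => Finsupp.single (n + 1) 1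
  | .vert 1, 0 => Finsupp.single 0 1
  | .vert 1, _ + 1 => 0
  | .edge 0, 0 => 0
  | .edge 0, n + 1 => Finsupp.single (n + 2) 1
  | .edge 1, 0 => Finsupp.single 1 1
  | .edge 1, _ + 1 => 0
  | .ghost 0, 0 => 0
  | .ghost 0, 1 => 0
  | .ghost 0, n + 2 => Finsupp.single (n + 1) 1
  | .ghost 1, 0 => 0
  | .ghost 1, 1 => Finsupp.single 0 1
  | .ghost 1, _ + 2 => 0

/-- The matrices of the generators of `L(Γ₁)`. -/
def matrixGen (g : Gen (Fin 2) (Fin 2)) : ColFin F :=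
  Finsupp.linearCombination F (matrixGenFun F g)

/-- The embedding of `L(Γ₁)` into the algebra of infinite matrices. In terms of matrix units with
indices from `0` on, the sink goes to `e₀₀`, the edge `d` into the sink to `e₁₀`, the loop `c` to
`∑_{i ≥ 1} e_{i+1,i}`, and `d^*`, `c^*` to the transposed matrices. -/
def toMatrix : Alg F →ₐ[F] ColFin F :=
  RingQuot.liftAlgHom F ⟨FreeAlgebra.lift F (matrixGen F), by
    intro a b h
    refine Finsupp.lhom_ext' fun i => LinearMap.ext_ring ?_
    cases h with
    | vert_mul_vert u v =>
      fin_cases u <;> fin_cases v <;> rcases i with _ | _ | i <;> simp [matrixGen, matrixGenFun]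
    | source_mul_edge e =>
      fin_cases e <;> rcases i with _ | _ | i <;> simp [matrixGen, matrixGenFun, graph]
    | edge_mul_range e =>
      fin_cases e <;> rcases i with _ | _ | i <;> simp [matrixGen, matrixGenFun, graph]
    | range_mul_ghost e =>
      fin_cases e <;> rcases i with _ | _ | i <;> simp [matrixGen, matrixGenFun, graph]
    | ghost_mul_source e =>
      fin_cases e <;> rcases i with _ | _ | i <;> simp [matrixGen, matrixGenFun, graph]
    | ghost_mul_edge e f =>
      fin_cases e <;> fin_cases f <;> rcases i with _ | _ | i <;>
        simp [matrixGen, matrixGenFun, graph]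
    | vert_eq_sum v hv =>
      fin_cases v
      · rcases i with _ | _ | i <;>
          simp [matrixGen, matrixGenFun, graph_s, Fin.sum_univ_two]
      · obtain ⟨e, he⟩ := hv
        fin_cases e <;> simp [graph] at he
    | sum_vert =>
      rcases i with _ | _ | i <;> simp [matrixGen, matrixGenFun, Fin.sum_univ_two]⟩

end

end Toeplitz

end

/-! Put x = c + d and y = c^* + d^*. Then yx = 1, the sink is 1 - xy, and x, y generate the algebra,
so L(Γ₁) is spanned by the words x^i y^j. The embedding ρ turns x into the unilateral shift and y
into its left inverse. The matrix units x^i (1 - xy) y^j span I₀, which ρ maps onto M_∞(F). Modulo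
finitary matrices, ρ(a) is the Toeplitz matrix whose diagonals carry the coefficients of the Laurent
polynomial of a, its symbol. This gives the kernel of the projection and the faithfulness of ρ.

Every automorphism φ is a conjugation: if φ(1 - xy) fixes w ≠ 0, the vectors φ(x)^i w form a basis
on which φ(x) and φ(y) act as the two shifts (`exists_unit_conj`). The symbol of φ(x) is a unit,
hence a monomial a t^k. A dimension count in the role of the Fredholm index gives k ≥ 0
(`nonneg_of_injective`), and the same for φ⁻¹ forces k = 1. Once π(a) is split off, the conjugating
matrix and its inverse commute with the shift on far basis vectors, so both lie in the image of ρ.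
Their symbols are constants, so up to a scalar the matrix is in GL_∞(F) (`exists_conjUnit`). Only
scalars commute with the image of ρ, which gives uniqueness of (g, α) and the description of T.

Under ρ the involution * is transposition. For an involution τ, the automorphism * ∘ τ is
conjugation by some U = g π(α), and U is symmetric (`isTranspose_conjUnit_self`). It is a finite
block followed by powers of α; when square roots exist, U is congruent to 1
(`exists_congruent_one`), and conjugation by the congruence matrix carries τ to *. -/

noncomputable section

namespace Toeplitz

open Leavitt

section
variable (F : Type*) [Field F]

/-! ### Generation by the shift and its left inverse. -/

/-- The isometry `c + d`, which acts on the basis `e₀, e₁, …` as the unilateral shift. -/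
def shift : Alg F := gen F graph (.edge 0) + gen F graph (.edge 1)

/-- The left inverse `c^* + d^*` of the shift. -/
def coshift : Alg F := gen F graph (.ghost 0) + gen F graph (.ghost 1)

/-- The idempotent of the sink. -/
def sink : Alg F := gen F graph (.vert 1)

variable {F}

theorem mkAlgHom_eq {a b : FreeAlgebra F (Gen (Fin 2) (Fin 2))} (h : Rel F graph a b) :
    RingQuot.mkAlgHom F (Rel F graph) a = RingQuot.mkAlgHom F (Rel F graph) b :=
  RingQuot.mkAlgHom_rel F h

theorem gen_vert_mul_vert (u v : Fin 2) :
    gen F graph (.vert u) * gen F graph (.vert v) = if u = v then gen F graph (.vert u) else 0 := by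
  have := mkAlgHom_eq (Rel.vert_mul_vert (F := F) (Γ := graph) u v)
  split_ifs at this ⊢ <;> simpa [gen] using this

theorem gen_edge_mul_range (e : Fin 2) :
    gen F graph (.edge e) * gen F graph (.vert (graph.r e)) = gen F graph (.edge e) := by
  simpa [gen] using mkAlgHom_eq (Rel.edge_mul_range (F := F) (Γ := graph) e)

theorem gen_range_mul_ghost (e : Fin 2) :
    gen F graph (.vert (graph.r e)) * gen F graph (.ghost e) = gen F graph (.ghost e) := by
  simpa [gen] using mkAlgHom_eq (Rel.range_mul_ghost (F := F) (Γ := graph) e)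

theorem gen_ghost_mul_edge (e f : Fin 2) :
    gen F graph (.ghost e) * gen F graph (.edge f) =
      if e = f then gen F graph (.vert (graph.r e)) else 0 := by
  have := mkAlgHom_eq (Rel.ghost_mul_edge (F := F) (Γ := graph) e f)
  split_ifs at this ⊢ <;> simpa [gen] using this

theorem gen_vert_zero : gen F graph (.vert 0) =
    gen F graph (.edge 0) * gen F graph (.ghost 0) +
      gen F graph (.edge 1) * gen F graph (.ghost 1) := by
  simpa [gen, graph_s, Fin.sum_univ_two] using
    mkAlgHom_eq (Rel.vert_eq_sum (F := F) (Γ := graph) 0 ⟨0, rfl⟩)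

theorem gen_sum_vert : gen F graph (.vert 0) + gen F graph (.vert 1) = 1 := by
  simpa [gen, Fin.sum_univ_two] using mkAlgHom_eq (Rel.sum_vert (F := F) (Γ := graph))

theorem gen_edge_mul_vert_ne (e v : Fin 2) (h : graph.r e ≠ v) :
    gen F graph (.edge e) * gen F graph (.vert v) = 0 := by
  rw [← gen_edge_mul_range, mul_assoc, gen_vert_mul_vert, if_neg h, mul_zero]

theorem gen_vert_mul_ghost_ne (e v : Fin 2) (h : v ≠ graph.r e) :
    gen F graph (.vert v) * gen F graph (.ghost e) = 0 := by
  rw [← gen_range_mul_ghost, ← mul_assoc, gen_vert_mul_vert, if_neg h, zero_mul]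

theorem coshift_mul_shift : coshift F * shift F = 1 := by
  have graph_r (e : Fin 2) : graph.r e = e := by fin_cases e <;> rfl
  simp only [coshift, shift, add_mul, mul_add, gen_ghost_mul_edge, ← gen_sum_vert, graph_r]
  simp

theorem shift_mul_coshift : shift F * coshift F = gen F graph (.vert 0) := by
  have h1 : gen F graph (.edge 0) * gen F graph (.ghost 1) = 0 := by
    rw [← gen_range_mul_ghost, ← mul_assoc, gen_edge_mul_vert_ne _ _ (by decide), zero_mul]
  have h2 : gen F graph (.edge 1) * gen F graph (.ghost 0) = 0 := by
    rw [← gen_range_mul_ghost, ← mul_assoc, gen_edge_mul_vert_ne _ _ (by decide), zero_mul]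
  simp [coshift, shift, add_mul, mul_add, gen_vert_zero, h1, h2]

theorem sink_eq : sink F = 1 - shift F * coshift F := by
  rw [shift_mul_coshift, ← gen_sum_vert, add_sub_cancel_left, sink]

theorem gen_edge_one : gen F graph (.edge 1) = shift F * sink F := by
  rw [shift, sink, add_mul, gen_edge_mul_vert_ne 0 1 (by decide), zero_add]
  exact (gen_edge_mul_range 1).symm

theorem gen_ghost_one : gen F graph (.ghost 1) = sink F * coshift F := by
  rw [coshift, sink, mul_add, gen_vert_mul_ghost_ne 0 1 (by decide), zero_add]
  exact (gen_range_mul_ghost 1).symm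

theorem adjoin_shift : Algebra.adjoin F {shift F, coshift F} = ⊤ := by
  set A := Algebra.adjoin F {shift F, coshift F}
  have hx : shift F ∈ A := Algebra.subset_adjoin (by simp)
  have hy : coshift F ∈ A := Algebra.subset_adjoin (by simp)
  have hs : sink F ∈ A := by rw [sink_eq]; exact sub_mem (one_mem _) (mul_mem hx hy)
  have hd : gen F graph (.edge 1) ∈ A := by rw [gen_edge_one]; exact mul_mem hx hs
  have hd' : gen F graph (.ghost 1) ∈ A := by rw [gen_ghost_one]; exact mul_mem hs hy
  have hg : ∀ g, gen F graph g ∈ A := by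
    rintro (v | e | e)
    · fin_cases v
      · have := mul_mem hx hy
        rwa [shift_mul_coshift] at this
      · exact hs
    · fin_cases e
      · have := sub_mem hx hd
        rwa [shift, add_sub_cancel_right] at this
      · exact hd
    · fin_cases e
      · have := sub_mem hy hd'
        rwa [coshift, add_sub_cancel_right] at this
      · exact hd'
  refine eq_top_iff.2 fun a _ => ?_
  obtain ⟨b, rfl⟩ := RingQuot.mkAlgHom_surjective F (Rel F graph) a
  induction b using FreeAlgebra.induction with
  | grade0 r => rw [AlgHom.commutes]; exact A.algebraMap_mem r
  | grade1 g => exact hg g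
  | mul a b ha hb => rw [map_mul]; exact mul_mem (ha trivial) (hb trivial)
  | add a b ha hb => rw [map_add]; exact add_mem (ha trivial) (hb trivial)

theorem algHom_ext {A : Type*} [Semiring A] [Algebra F A] {f g : Alg F →ₐ[F] A}
    (h1 : f (shift F) = g (shift F)) (h2 : f (coshift F) = g (coshift F)) : f = g := by
  refine AlgHom.ext_of_adjoin_eq_top adjoin_shift ?_
  rintro _ (rfl | rfl)
  · exact h1
  · exact h2

/-- Since yx = 1, multiplying x^i y^j on the left by x or y gives a word of the same form. The span
is therefore a left ideal, and it contains 1. -/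
theorem span_shift_pow_mul_coshift_pow :
    Submodule.span F (Set.range fun p : ℕ × ℕ => shift F ^ p.1 * coshift F ^ p.2) = ⊤ := by
  set N := Submodule.span F (Set.range fun p : ℕ × ℕ => shift F ^ p.1 * coshift F ^ p.2)
  have hN (i j : ℕ) : shift F ^ i * coshift F ^ j ∈ N := Submodule.subset_span ⟨(i, j), rfl⟩
  have hx (a) (ha : a ∈ N) : shift F * a ∈ N := by
    induction ha using Submodule.span_induction with
    | mem a h =>
      obtain ⟨⟨i, j⟩, rfl⟩ := h
      have := hN (i + 1) j
      rwa [pow_succ', mul_assoc] at this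
    | zero => simp
    | add a b _ _ ha hb => rw [mul_add]; exact add_mem ha hb
    | smul r a _ ha => rw [mul_smul_comm]; exact N.smul_mem r ha
  have hy (a) (ha : a ∈ N) : coshift F * a ∈ N := by
    induction ha using Submodule.span_induction with
    | mem a h =>
      obtain ⟨⟨i, j⟩, rfl⟩ := h
      rcases i with _ | i
      · have := hN 0 (j + 1)
        simpa [pow_succ'] using this
      · have := hN i j
        simpa only [pow_succ', ← mul_assoc, coshift_mul_shift, one_mul] using this
    | zero => simp
    | add a b _ _ ha hb => rw [mul_add]; exact add_mem ha hb
    | smul r a _ ha => rw [mul_smul_comm]; exact N.smul_mem r ha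
  have key (a : Alg F) : ∀ b ∈ N, a * b ∈ N := by
    have ha : a ∈ Algebra.adjoin F {shift F, coshift F} := by rw [adjoin_shift]; trivial
    induction ha using Algebra.adjoin_induction with
    | mem a h =>
      rcases h with rfl | rfl
      · exact hx
      · exact hy
    | algebraMap r =>
      intro b hb
      rw [← Algebra.smul_def]
      exact N.smul_mem r hb
    | add a b _ _ ha hb => intro c hc; rw [add_mul]; exact add_mem (ha c hc) (hb c hc)
    | mul a b _ _ ha hb => intro c hc; rw [mul_assoc]; exact ha _ (hb c hc)
  refine eq_top_iff.2 fun a _ => ?_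
  simpa using key a 1 (by simpa using hN 0 0)

/-! ### Matrix units -/

/-- The matrix units of the ideal generated by the sink. -/
def matUnit (i j : ℕ) : Alg F := shift F ^ i * sink F * coshift F ^ j

/-- This is what makes x^(i+1) y^(j+1) and x^i y^j congruent modulo the matrix units. -/
theorem matUnit_eq (i j : ℕ) : matUnit i j =
    shift F ^ i * coshift F ^ j - shift F ^ (i + 1) * coshift F ^ (j + 1) := by
  rw [matUnit, sink_eq, pow_succ, pow_succ', mul_sub, sub_mul, mul_one]
  simp only [mul_assoc]

theorem toMatrix_gen (g : Gen (Fin 2) (Fin 2)) : toMatrix F (gen F graph g) = matrixGen F g := by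
  simp [toMatrix, gen, RingQuot.liftAlgHom_mkAlgHom_apply]

theorem toLaurent_gen (g : Gen (Fin 2) (Fin 2)) : toLaurent F (gen F graph g) = laurentGen F g := by
  simp [toLaurent, gen, RingQuot.liftAlgHom_mkAlgHom_apply]

theorem toMatrix_shift_single (n : ℕ) (a : F) :
    toMatrix F (shift F) (Finsupp.single n a) = Finsupp.single (n + 1) a := by
  rcases n with _ | n <;> simp [shift, toMatrix_gen, matrixGen, matrixGenFun]

theorem toMatrix_coshift_single_zero (a : F) :
    toMatrix F (coshift F) (Finsupp.single 0 a) = 0 := by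
  simp [coshift, toMatrix_gen, matrixGen, matrixGenFun]

theorem toMatrix_coshift_single_succ (n : ℕ) (a : F) :
    toMatrix F (coshift F) (Finsupp.single (n + 1) a) = Finsupp.single n a := by
  rcases n with _ | n <;> simp [coshift, toMatrix_gen, matrixGen, matrixGenFun]

theorem toMatrix_sink_single (n : ℕ) (a : F) :
    toMatrix F (sink F) (Finsupp.single n a) = if n = 0 then Finsupp.single 0 a else 0 := by
  rcases n with _ | n <;> simp [sink, toMatrix_gen, matrixGen, matrixGenFun]

theorem toMatrix_shift_pow_single (k n : ℕ) (a : F) :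
    (toMatrix F (shift F) ^ k) (Finsupp.single n a) = Finsupp.single (n + k) a := by
  induction k with
  | zero => simp
  | succ k ih => rw [pow_succ', Module.End.mul_apply, ih, toMatrix_shift_single, add_assoc]

theorem toMatrix_coshift_pow_single (k n : ℕ) (a : F) :
    (toMatrix F (coshift F) ^ k) (Finsupp.single n a) =
      if k ≤ n then Finsupp.single (n - k) a else 0 := by
  induction k with
  | zero => simp
  | succ k ih =>
    rw [pow_succ', Module.End.mul_apply, ih]
    split_ifs with h1 h2 h2
    · rw [show n - k = n - (k + 1) + 1 by omega, toMatrix_coshift_single_succ]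
    · rw [show n - k = 0 by omega, toMatrix_coshift_single_zero]
    · omega
    · simp

theorem toMatrix_matUnit_single (i j k : ℕ) (a : F) :
    toMatrix F (matUnit i j) (Finsupp.single k a) = if k = j then Finsupp.single i a else 0 := by
  simp only [matUnit, map_mul, map_pow, Module.End.mul_apply, toMatrix_coshift_pow_single]
  split_ifs with h1 h2 h2
  · subst h2; simp [toMatrix_sink_single, toMatrix_shift_pow_single]
  · rw [toMatrix_sink_single, if_neg (by omega), map_zero]
  · omega
  · simp

theorem toLaurent_shift : toLaurent F (shift F) = LaurentPolynomial.T 1 := by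
  simp [shift, toLaurent_gen, laurentGen]

theorem toLaurent_coshift : toLaurent F (coshift F) = LaurentPolynomial.T (-1) := by
  simp [coshift, toLaurent_gen, laurentGen]

theorem toLaurent_sink : toLaurent F (sink F) = 0 := by
  simp [sink, toLaurent_gen, laurentGen]

theorem toLaurent_matUnit (i j : ℕ) : toLaurent F (matUnit i j) = 0 := by
  simp [matUnit, toLaurent_sink]

/-- The powers of the shift with integer exponents. -/
def shiftZPow (n : ℤ) : Alg F := shift F ^ n.toNat * coshift F ^ (-n).toNat

theorem toLaurent_shiftZPow (n : ℤ) :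
    toLaurent F (shiftZPow n) = LaurentPolynomial.T n := by
  rw [shiftZPow, map_mul, map_pow, map_pow, toLaurent_shift, toLaurent_coshift,
    LaurentPolynomial.T_pow, LaurentPolynomial.T_pow, ← LaurentPolynomial.T_add]
  congr 1
  omega

variable (F) in
/-- The linear section of the projection onto the Laurent polynomials. -/
def laurentSection : F[T;T⁻¹] →ₗ[F] Alg F :=
  (Finsupp.linearCombination F fun n : ℤ => (shiftZPow n : Alg F)) ∘ₗ
    (AddMonoidAlgebra.coeffLinearEquiv F).toLinearMap

theorem laurentSection_T (n : ℤ) :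
    laurentSection F (LaurentPolynomial.T n) = shiftZPow n := by
  show Finsupp.linearCombination F _ (Finsupp.single n 1) = _
  simp

end

/-! ### The kernel of the projection onto the Laurent polynomials. -/

section
variable {F : Type*} [Field F]

theorem sub_laurentSection_mem (a : Alg F) : a - laurentSection F (toLaurent F a) ∈
    Submodule.span F (Set.range fun p : ℕ × ℕ => (matUnit p.1 p.2 : Alg F)) := by
  have ha : a ∈ Submodule.span F
      (Set.range fun p : ℕ × ℕ => shift F ^ p.1 * coshift F ^ p.2) := by
    rw [span_shift_pow_mul_coshift_pow]; trivial
  induction ha using Submodule.span_induction with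
  | zero => simp
  | add a b _ _ ha hb => rw [map_add, map_add, add_sub_add_comm]; exact add_mem ha hb
  | smul r a _ ha => rw [map_smul, map_smul, ← smul_sub]; exact Submodule.smul_mem _ r ha
  | mem a h =>
    obtain ⟨⟨i, j⟩, rfl⟩ := h
    simp only
    -- A word with one exponent zero is an integral power of the shift, on which the section inverts
    -- the projection. The induction lowers both exponents together until this case is reached.
    have base (i j : ℕ) (h : i = 0 ∨ j = 0) : shift F ^ i * coshift F ^ j
        - laurentSection F (toLaurent F (shift F ^ i * coshift F ^ j)) = 0 := by
      have h1 : shift F ^ i * coshift F ^ j = shiftZPow ((i : ℤ) - j) := by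
        rw [shiftZPow]; congr 2 <;> omega
      rw [h1, toLaurent_shiftZPow, laurentSection_T, sub_self]
    induction i generalizing j with
    | zero => rw [base 0 j (Or.inl rfl)]; exact zero_mem _
    | succ i ih =>
      rcases j with _ | j
      · rw [base _ 0 (Or.inr rfl)]; exact zero_mem _
      · have h1 : shift F ^ (i + 1) * coshift F ^ (j + 1) =
            shift F ^ i * coshift F ^ j - matUnit i j := by rw [matUnit_eq, sub_sub_cancel]
        rw [h1, map_sub, toLaurent_matUnit, sub_zero, sub_right_comm]
        exact sub_mem (ih j) (Submodule.subset_span ⟨(i, j), rfl⟩)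

theorem mem_span_matUnit {a : Alg F} (h : toLaurent F a = 0) :
    a ∈ Submodule.span F (Set.range fun p : ℕ × ℕ => (matUnit p.1 p.2 : Alg F)) := by
  simpa [h] using sub_laurentSection_mem a

theorem toLaurent_surjective : Function.Surjective (toLaurent F) := by
  intro p
  induction p using LaurentPolynomial.induction_on' with
  | add p q hp hq =>
    obtain ⟨a, rfl⟩ := hp
    obtain ⟨b, rfl⟩ := hq
    exact ⟨a + b, map_add _ _ _⟩
  | C_mul_T n r =>
    exact ⟨r • shiftZPow n, by
      rw [map_smul, toLaurent_shiftZPow, LaurentPolynomial.smul_eq_C_mul]⟩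

theorem mem_sinkIdeal_iff {a : Alg F} : a ∈ sinkIdeal F ↔ toLaurent F a = 0 := by
  constructor
  · intro h
    have : sinkIdeal F ≤ TwoSidedIdeal.ker (toLaurent F) := by
      rw [sinkIdeal, TwoSidedIdeal.span_le]
      rintro _ rfl
      exact (TwoSidedIdeal.mem_ker _).2 toLaurent_sink
    exact (TwoSidedIdeal.mem_ker _).1 (this h)
  · intro h
    have ha := mem_span_matUnit h
    clear h
    induction ha using Submodule.span_induction with
    | zero => exact zero_mem _
    | add a b _ _ ha hb => exact add_mem ha hb
    | smul r a _ ha =>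
      rw [Algebra.smul_def]
      exact TwoSidedIdeal.mul_mem_left _ _ _ ha
    | mem a h =>
      obtain ⟨⟨i, j⟩, rfl⟩ := h
      exact TwoSidedIdeal.mul_mem_right _ _ _ (TwoSidedIdeal.mul_mem_left _ _ _
        (TwoSidedIdeal.subset_span rfl))

theorem ker_toLaurent : TwoSidedIdeal.ker (toLaurent F) = sinkIdeal F := by
  ext a
  rw [mem_sinkIdeal_iff, TwoSidedIdeal.mem_ker]

/-! ### Finitary matrices -/

theorem isFinitary_zero : IsFinitary (0 : ColFin F) := by simp [IsFinitary, entry]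

theorem IsFinitary.smul {T : ColFin F} (r : F) (hT : IsFinitary T) : IsFinitary (r • T) := by
  simpa using hT.mul_left (r • (1 : ColFin F))

theorem isFinitary_iff_eventually (T : ColFin F) :
    IsFinitary T ↔ ∀ᶠ j in Filter.atTop, T (Finsupp.single j 1) = 0 := by
  rw [isFinitary_iff, ← Nat.cofinite_eq_atTop]
  rfl

theorem isFinitary_iff_exists_forall (T : ColFin F) :
    IsFinitary T ↔ ∃ N : ℕ, ∀ j, N ≤ j → T (Finsupp.single j 1) = 0 := by
  rw [isFinitary_iff_eventually, Filter.eventually_atTop]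

theorem isFinitary_toMatrix {a : Alg F} (h : toLaurent F a = 0) : IsFinitary (toMatrix F a) := by
  have ha := mem_span_matUnit h
  clear h
  induction ha using Submodule.span_induction with
  | zero => simpa using isFinitary_zero
  | add a b _ _ ha hb => rw [map_add]; exact ha.add hb
  | smul r a _ ha => rw [map_smul]; exact ha.smul r
  | mem a h =>
    obtain ⟨⟨i, j⟩, rfl⟩ := h
    rw [isFinitary_iff_exists_forall]
    refine ⟨j + 1, fun k hk => ?_⟩
    rw [toMatrix_matUnit_single, if_neg (by simp only; omega)]

/-- The element of the ideal of the sink whose matrix has a given `j`-th column, and zeros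
elsewhere. -/
def column (j : ℕ) : (ℕ →₀ F) →ₗ[F] Alg F :=
  Finsupp.linearCombination F fun i => matUnit i j

theorem toMatrix_column_single (j k : ℕ) (v : ℕ →₀ F) :
    toMatrix F (column j v) (Finsupp.single k 1) = if k = j then v else 0 := by
  induction v using Finsupp.induction_linear with
  | zero => simp
  | add v w hv hw => rw [map_add, map_add, LinearMap.add_apply, hv, hw]; split_ifs <;> simp
  | single i r =>
    rw [column, Finsupp.linearCombination_single, map_smul, LinearMap.smul_apply,
      toMatrix_matUnit_single]
    split_ifs <;> simp

theorem toLaurent_column (j : ℕ) (v : ℕ →₀ F) : toLaurent F (column j v) = 0 := by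
  induction v using Finsupp.induction_linear with
  | zero => simp
  | add v w hv hw => rw [map_add, map_add, hv, hw, add_zero]
  | single i r =>
    rw [column, Finsupp.linearCombination_single, map_smul, toLaurent_matUnit, smul_zero]

theorem colFin_ext {S T : ColFin F}
    (h : ∀ j, S (Finsupp.single j 1) = T (Finsupp.single j 1)) : S = T :=
  Finsupp.lhom_ext' fun j => LinearMap.ext_ring (h j)

/-- The image of the ideal of the sink is all of M_∞(F): a finitary matrix is the sum of its
finitely many nonzero columns. -/
theorem IsFinitary.exists_toMatrix_eq {T : ColFin F} (hT : IsFinitary T) :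
    ∃ a : Alg F, toLaurent F a = 0 ∧ toMatrix F a = T := by
  obtain ⟨N, hN⟩ := (isFinitary_iff_exists_forall T).1 hT
  refine ⟨∑ j ∈ Finset.range N, column j (T (Finsupp.single j 1)), ?_, colFin_ext fun k => ?_⟩
  · rw [map_sum]
    exact Finset.sum_eq_zero fun j _ => toLaurent_column j _
  · rw [map_sum, LinearMap.sum_apply]
    simp only [toMatrix_column_single, Finset.sum_ite_eq, Finset.mem_range]
    split_ifs with h
    · rfl
    · rw [hN k (not_lt.1 h)]

/-! ### Symbols of Toeplitz matrices and faithfulness. -/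

theorem toMatrix_shiftZPow_single (n : ℤ) (j : ℕ) :
    toMatrix F (shiftZPow n) (Finsupp.single j 1) =
      if 0 ≤ j + n then Finsupp.single (j + n).toNat 1 else 0 := by
  rw [shiftZPow, map_mul, map_pow, map_pow, Module.End.mul_apply, toMatrix_coshift_pow_single]
  by_cases h : 0 ≤ j + n
  · rw [if_pos h, if_pos (by omega), toMatrix_shift_pow_single]
    congr 1
    omega
  · rw [if_neg h, if_neg (by omega), map_zero]

theorem entry_laurentSection (p : F[T;T⁻¹]) (i j : ℕ) :
    entry (toMatrix F (laurentSection F p)) i j = p.coeff ((i : ℤ) - j) := by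
  induction p using LaurentPolynomial.induction_on' with
  | add p q hp hq =>
    rw [entry] at *
    rw [map_add, map_add, LinearMap.add_apply, Finsupp.add_apply, hp, hq]
    rfl
  | C_mul_T n r =>
    rw [← LaurentPolynomial.smul_eq_C_mul, entry, map_smul, map_smul, LinearMap.smul_apply,
      laurentSection_T, toMatrix_shiftZPow_single]
    have h1 : (r • (LaurentPolynomial.T n : F[T;T⁻¹])).coeff ((i : ℤ) - j) =
      r * (LaurentPolynomial.T n : F[T;T⁻¹]).coeff ((i : ℤ) - j) := rfl
    rw [h1, LaurentPolynomial.T_apply]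
    split_ifs with h2 h3 h3
    · simp [h3]
    · rw [Finsupp.smul_apply, Finsupp.single_apply, if_neg (by omega)]; simp
    · omega
    · simp

theorem toLaurent_laurentSection (p : F[T;T⁻¹]) : toLaurent F (laurentSection F p) = p := by
  induction p using LaurentPolynomial.induction_on' with
  | add p q hp hq => rw [map_add, map_add, hp, hq]
  | C_mul_T n r =>
    rw [← LaurentPolynomial.smul_eq_C_mul, map_smul, map_smul, laurentSection_T,
      toLaurent_shiftZPow]

theorem eventually_toMatrix_eq {a b : Alg F} (h : toLaurent F a = toLaurent F b) :
    ∀ᶠ j in Filter.atTop, toMatrix F a (Finsupp.single j 1) =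
      toMatrix F b (Finsupp.single j 1) := by
  have h1 := isFinitary_toMatrix (a := a - b) (by rw [map_sub, h, sub_self])
  rw [isFinitary_iff_eventually] at h1
  filter_upwards [h1] with j hj
  rw [← sub_add_cancel a b, map_add, LinearMap.add_apply, hj, zero_add]

/-- The coefficient of t^n is constant along a diagonal of the Toeplitz part, so it can be read off
in a column beyond which the finitary matrix vanishes. -/
theorem toLaurent_eq_zero_of_isFinitary {a : Alg F} (h : IsFinitary (toMatrix F a)) :
    toLaurent F a = 0 := by
  have h1 := eventually_toMatrix_eq (toLaurent_laurentSection (toLaurent F a))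
  rw [isFinitary_iff_eventually] at h
  obtain ⟨N, hN⟩ := Filter.eventually_atTop.1 (h.and h1)
  ext n
  -- The summand `n.natAbs` keeps the row index nonnegative, so that `toNat` does not truncate it.
  have h2 := entry_laurentSection (toLaurent F a) (N + n.natAbs + n).toNat (N + n.natAbs)
  obtain ⟨h3, h4⟩ := hN (N + n.natAbs) (by omega)
  rw [entry, h4, h3] at h2
  rw [show (((N + n.natAbs + n).toNat : ℕ) : ℤ) - ((N + n.natAbs : ℕ) : ℤ) = n by omega] at h2
  simpa using h2.symm

/-- The zero matrix is finitary, so an element of the kernel is a combination of matrix units, and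
the entries of its matrix are the coefficients. -/
theorem toMatrix_injective : Function.Injective (toMatrix F) := by
  rw [injective_iff_map_eq_zero]
  intro a ha
  have h1 := mem_span_matUnit (toLaurent_eq_zero_of_isFinitary (a := a)
    (by rw [ha]; exact isFinitary_zero))
  obtain ⟨c, rfl⟩ := (Finsupp.mem_span_range_iff_exists_finsupp).1 h1
  have h2 (i j : ℕ) : c (i, j) = 0 := by
    have h3 : toMatrix F (c.sum fun p r => r • matUnit p.1 p.2) (Finsupp.single j 1) i =
        c (i, j) := by
      rw [Finsupp.sum, map_sum, LinearMap.sum_apply, Finsupp.finsetSum_apply]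
      simp only [map_smul, LinearMap.smul_apply, toMatrix_matUnit_single, Finsupp.smul_apply]
      rw [Finset.sum_eq_single (i, j)]
      · simp
      · rintro ⟨i', j'⟩ _ hne
        simp only
        split_ifs with h4
        · have : i' ≠ i := fun h5 => hne (by rw [h4, h5])
          simp [this]
        · simp
      · intro h4
        rw [Finsupp.notMem_support_iff.1 h4, zero_smul]
    rw [← h3, ha]; rfl
  have h3 : c = 0 := by ext ⟨i, j⟩; exact h2 i j
  rw [h3, Finsupp.sum_zero_index]

end

/-! ### Conjugation by GL_∞(F) and by the matrices π(α). -/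

section
variable {F : Type*} [Field F]

theorem toMatrix_matUnit_apply (i j : ℕ) (v : ℕ →₀ F) :
    toMatrix F (matUnit i j) v = Finsupp.single i (v j) := by
  induction v using Finsupp.induction_linear with
  | zero => simp
  | add v w hv hw => rw [map_add, hv, hw, Finsupp.add_apply, Finsupp.single_add]
  | single k r =>
    rw [toMatrix_matUnit_single, Finsupp.single_apply]
    split_ifs <;> simp

theorem toMatrix_column_apply (j : ℕ) (v w : ℕ →₀ F) :
    toMatrix F (column j v) w = w j • v := by
  induction w using Finsupp.induction_linear with
  | zero => simp
  | add w w' hw hw' => rw [map_add, hw, hw', Finsupp.add_apply, add_smul]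
  | single k r =>
    rw [← mul_one r, ← smul_eq_mul, ← Finsupp.smul_single, map_smul, toMatrix_column_single,
      Finsupp.smul_apply, Finsupp.single_apply]
    split_ifs <;> simp

/-- Only scalars commute with the image of the Toeplitz algebra. -/
theorem exists_eq_smul_one {A : ColFin F} (h : ∀ x, A * toMatrix F x = toMatrix F x * A) :
    ∃ r : F, A = r • (1 : ColFin F) := by
  refine ⟨A (Finsupp.single 0 1) 0, colFin_ext fun i => ?_⟩
  -- Commuting with e_{i0} and evaluating at e₀ gives A e_i = A₀₀ e_i.
  have h1 := LinearMap.congr_fun (h (matUnit i 0)) (Finsupp.single 0 1)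
  rw [Module.End.mul_apply, Module.End.mul_apply, toMatrix_matUnit_apply,
    toMatrix_matUnit_apply] at h1
  simpa using h1

theorem mem_GLInf_iff {T : (ColFin F)ˣ} : T ∈ GLInf F ↔
    ∀ᶠ j in Filter.atTop, (T : ColFin F) (Finsupp.single j 1) = Finsupp.single j 1 := by
  constructor
  · rintro ⟨a, ha, hT⟩
    rw [isFinitary_iff_eventually] at ha
    filter_upwards [ha] with j hj
    rw [hT, LinearMap.add_apply, hj, add_zero, Module.End.one_apply]
  · intro h
    refine ⟨T + (-1 : F) • (1 : ColFin F), ?_, ?_⟩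
    · rw [isFinitary_iff_eventually]
      filter_upwards [h] with j hj
      simp [hj]
    · refine LinearMap.ext fun v => ?_
      simp

theorem diag_single (α : Fˣ) (j : ℕ) (a : F) :
    (diag F α : ColFin F) (Finsupp.single j a) = Finsupp.single j ((α : F) ^ j * a) := by
  simp [diag, diagEnd, mul_comm]

/-- Conjugation by a unit maps the image of the Toeplitz algebra into itself. -/
def Stabilizes (U : (ColFin F)ˣ) : Prop :=
  ∀ x : Alg F, ∃ y : Alg F, toMatrix F y = U * toMatrix F x * (U⁻¹ : (ColFin F)ˣ)

theorem Stabilizes.mul {U V : (ColFin F)ˣ} (hU : Stabilizes U) (hV : Stabilizes V) :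
    Stabilizes (U * V) := fun x => by
  obtain ⟨y, hy⟩ := hV x
  obtain ⟨z, hz⟩ := hU y
  exact ⟨z, by rw [hz, hy]; simp only [mul_inv_rev, Units.val_mul, mul_assoc]⟩

theorem IsFinitary.exists_toMatrix_eq_one_add {a : ColFin F} (ha : IsFinitary a) :
    ∃ u : Alg F, toLaurent F u = 1 ∧ toMatrix F u = 1 + a := by
  obtain ⟨b, hb, rfl⟩ := ha.exists_toMatrix_eq
  exact ⟨1 + b, by simp [hb], by simp⟩

theorem exists_toMatrix_eq_of_mem_GLInf {U : (ColFin F)ˣ} (hU : U ∈ GLInf F) :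
    ∃ u : Alg F, toLaurent F u = 1 ∧ toMatrix F u = U := by
  obtain ⟨a, ha, h⟩ := hU
  rw [h]
  exact ha.exists_toMatrix_eq_one_add

/-- Both the matrix and its inverse lie in the image of the algebra, so the conjugation is inner. -/
theorem stabilizes_of_mem_GLInf {U : (ColFin F)ˣ} (hU : U ∈ GLInf F) : Stabilizes U := fun x => by
  obtain ⟨u, -, hu⟩ := exists_toMatrix_eq_of_mem_GLInf hU
  obtain ⟨u', -, hu'⟩ := exists_toMatrix_eq_of_mem_GLInf (inv_mem hU)
  exact ⟨u * x * u', by rw [map_mul, map_mul, hu, hu']⟩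

theorem diag_mul_shift (α : Fˣ) : (diag F α : ColFin F) * toMatrix F (shift F) =
    (α : F) • (toMatrix F (shift F) * (diag F α : ColFin F)) := by
  refine colFin_ext fun j => ?_
  simp [toMatrix_shift_single, diag_single, pow_succ']

theorem diag_mul_coshift (α : Fˣ) : (diag F α : ColFin F) * toMatrix F (coshift F) =
    ((α⁻¹ : Fˣ) : F) • (toMatrix F (coshift F) * (diag F α : ColFin F)) := by
  refine colFin_ext fun j => ?_
  rcases j with _ | j
  · simp [toMatrix_coshift_single_zero, diag_single]
  · simp only [Module.End.mul_apply, LinearMap.smul_apply, toMatrix_coshift_single_succ,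
      diag_single, Finsupp.smul_single, smul_eq_mul]
    rw [pow_succ', mul_assoc, Units.inv_mul_cancel_left]

theorem stabilizes_diag (α : Fˣ) : Stabilizes (diag F α) := fun x => by
  have hx : x ∈ Algebra.adjoin F {shift F, coshift F} := by rw [adjoin_shift]; trivial
  induction hx using Algebra.adjoin_induction with
  | mem x h =>
    rcases h with rfl | rfl
    · exact ⟨(α : F) • shift F, by
        rw [diag_mul_shift, map_smul, smul_mul_assoc, mul_assoc, Units.mul_inv, mul_one]⟩
    · exact ⟨((α⁻¹ : Fˣ) : F) • coshift F, by
        rw [diag_mul_coshift, map_smul, smul_mul_assoc, mul_assoc, Units.mul_inv, mul_one]⟩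
  | algebraMap r =>
    exact ⟨algebraMap F _ r, by
      rw [AlgHom.commutes, ← Algebra.commutes, mul_assoc, Units.mul_inv, mul_one]⟩
  | add a b _ _ ha hb =>
    obtain ⟨a', ha⟩ := ha
    obtain ⟨b', hb⟩ := hb
    exact ⟨a' + b', by rw [map_add, map_add, mul_add, add_mul, ha, hb]⟩
  | mul a b _ _ ha hb =>
    obtain ⟨a', ha⟩ := ha
    obtain ⟨b', hb⟩ := hb
    exact ⟨a' * b', by
      rw [map_mul, map_mul, ha, hb]
      simp only [mul_assoc, Units.inv_mul_cancel_left]⟩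

theorem Stabilizes.exists_algEquiv {U : (ColFin F)ˣ} (hU : Stabilizes U) (hU' : Stabilizes U⁻¹) :
    ∃ φ : Alg F ≃ₐ[F] Alg F, ∀ x, toMatrix F (φ x) = U * toMatrix F x * (U⁻¹ : (ColFin F)ˣ) := by
  choose f hf using hU
  choose g hg using hU'
  have hinj := toMatrix_injective (F := F)
  refine ⟨AlgEquiv.ofAlgHom
    { toFun := f
      map_one' := hinj (by simp [hf])
      map_mul' := fun a b => hinj (by
        rw [hf, map_mul, map_mul, hf, hf]
        simp only [mul_assoc, Units.inv_mul_cancel_left])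
      map_zero' := hinj (by simp [hf])
      map_add' := fun a b => hinj (by rw [hf, map_add, map_add, hf, hf, mul_add, add_mul])
      commutes' := fun r => hinj (by
        rw [hf, AlgHom.commutes, ← Algebra.commutes, mul_assoc, Units.mul_inv, mul_one]) }
    { toFun := g
      map_one' := hinj (by simp [hg])
      map_mul' := fun a b => hinj (by
        rw [hg, map_mul, map_mul, hg, hg]
        simp only [mul_assoc, inv_inv, Units.mul_inv_cancel_left])
      map_zero' := hinj (by simp [hg])
      map_add' := fun a b => hinj (by rw [hg, map_add, map_add, hg, hg, mul_add, add_mul])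
      commutes' := fun r => hinj (by
        rw [hg, AlgHom.commutes, ← Algebra.commutes, mul_assoc, Units.mul_inv, mul_one]) }
    ?_ ?_, hf⟩
  · refine AlgHom.ext fun x => hinj ?_
    simp [hf, hg, mul_assoc]
  · refine AlgHom.ext fun x => hinj ?_
    simp [hf, hg, mul_assoc]

variable (F) in
/-- The subgroup of the units of `E` generated by `GL_∞(F)` and the matrices `π(α)`, as the image
of the semidirect product. -/
def conjUnit : GLInf F ⋊[diagAction F] Fˣ →* (ColFin F)ˣ :=
  SemidirectProduct.lift (GLInf F).subtype (diag F) fun α => by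
    ext1 g
    rfl

theorem conjUnit_mk (g : GLInf F) (α : Fˣ) : conjUnit F ⟨g, α⟩ = g * diag F α := rfl

theorem stabilizes_conjUnit (s : GLInf F ⋊[diagAction F] Fˣ) : Stabilizes (conjUnit F s) :=
  (stabilizes_of_mem_GLInf s.left.2).mul (stabilizes_diag s.right)

theorem exists_algEquiv_conjUnit (s : GLInf F ⋊[diagAction F] Fˣ) :
    ∃ φ : Alg F ≃ₐ[F] Alg F, ∀ x, toMatrix F (φ x) =
      conjUnit F s * toMatrix F x * ((conjUnit F s)⁻¹ : (ColFin F)ˣ) :=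
  (stabilizes_conjUnit s).exists_algEquiv (by rw [← map_inv]; exact stabilizes_conjUnit _)

/-- The component α is visible in the far columns, where g is the identity. -/
theorem conjUnit_single_eventually (s : GLInf F ⋊[diagAction F] Fˣ) :
    ∀ᶠ j in Filter.atTop, (conjUnit F s : ColFin F) (Finsupp.single j 1) =
      Finsupp.single j ((s.right : F) ^ j) := by
  obtain ⟨g, α⟩ := s
  filter_upwards [mem_GLInf_iff.1 g.2] with j hj
  rw [conjUnit_mk, Units.val_mul, Module.End.mul_apply, diag_single, ← smul_eq_mul,
    ← Finsupp.smul_single, map_smul, hj, Finsupp.smul_single, smul_eq_mul, mul_one]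

/-- A scalar r would equal α^j for all large j; two consecutive values give α = 1, and then r = 1.
-/
theorem eq_one_of_conjUnit_eq_smul {s : GLInf F ⋊[diagAction F] Fˣ} {r : F}
    (h : (conjUnit F s : ColFin F) = r • (1 : ColFin F)) : s = 1 := by
  obtain ⟨N, hN⟩ := Filter.eventually_atTop.1 (conjUnit_single_eventually s)
  have h1 (j : ℕ) (hj : N ≤ j) : r = (s.right : F) ^ j := by
    have h2 := DFunLike.congr_fun (hN j hj) j
    simpa [h] using h2
  have h2 : s.right = 1 := by
    have h3 := h1 (N + 1) (by omega)
    rw [h1 N le_rfl, pow_succ] at h3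
    have h4 : (s.right : F) ^ N ≠ 0 := pow_ne_zero _ s.right.ne_zero
    ext
    exact (mul_left_cancel₀ h4 (by rw [← h3, Units.val_one, mul_one]))
  have h3 : r = 1 := by rw [h1 N le_rfl, h2]; simp
  have h4 : conjUnit F s = 1 := by ext1; rw [h, h3, one_smul, Units.val_one]
  obtain ⟨g, α⟩ := s
  simp only at h2
  rw [conjUnit_mk, h2, map_one, mul_one] at h4
  have h5 : g = 1 := by ext1; exact h4
  rw [h5, h2]; rfl

variable (F) in
/-- The homomorphism which sends `(g, α)` to the automorphism induced by conjugation with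
`g π(α)`. -/
def conjAut : GLInf F ⋊[diagAction F] Fˣ →* (Alg F ≃ₐ[F] Alg F) where
  toFun s := (exists_algEquiv_conjUnit s).choose
  map_one' := by
    ext1 x
    refine toMatrix_injective ?_
    rw [(exists_algEquiv_conjUnit 1).choose_spec x]
    simp
  map_mul' s t := by
    ext1 x
    refine toMatrix_injective ?_
    rw [(exists_algEquiv_conjUnit (s * t)).choose_spec x, AlgEquiv.mul_apply,
      (exists_algEquiv_conjUnit s).choose_spec, (exists_algEquiv_conjUnit t).choose_spec]
    simp only [map_mul, mul_inv_rev, Units.val_mul, mul_assoc]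

theorem toMatrix_conjAut (s : GLInf F ⋊[diagAction F] Fˣ) (x : Alg F) :
    toMatrix F (conjAut F s x) =
      conjUnit F s * toMatrix F x * ((conjUnit F s)⁻¹ : (ColFin F)ˣ) :=
  (exists_algEquiv_conjUnit s).choose_spec x

theorem commute_of_conj_eq {U : (ColFin F)ˣ}
    (h : ∀ x, toMatrix F x = U * toMatrix F x * (U⁻¹ : (ColFin F)ˣ)) (x : Alg F) :
    (U : ColFin F) * toMatrix F x = toMatrix F x * U := by
  conv_rhs => rw [h x]
  rw [mul_assoc _ _ (U : ColFin F), Units.inv_mul, mul_one]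

theorem conjAut_injective : Function.Injective (conjAut F) := by
  rw [injective_iff_map_eq_one]
  intro s hs
  obtain ⟨r, hr⟩ := exists_eq_smul_one (commute_of_conj_eq (U := conjUnit F s) fun x => by
    rw [← toMatrix_conjAut, hs, AlgEquiv.one_apply])
  exact eq_one_of_conjUnit_eq_smul hr

end

section
variable {F : Type*} [Field F]

/-! ### Automorphisms are conjugations -/

theorem comp_toMatrix_eq {A : ColFin F} {ψ : Alg F →ₐ[F] ColFin F}
    (h1 : A * toMatrix F (shift F) = ψ (shift F) * A)
    (h2 : A * toMatrix F (coshift F) = ψ (coshift F) * A) (x : Alg F) :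
    A * toMatrix F x = ψ x * A := by
  have hx : x ∈ Algebra.adjoin F {shift F, coshift F} := by rw [adjoin_shift]; trivial
  induction hx using Algebra.adjoin_induction with
  | mem x h =>
    rcases h with rfl | rfl
    · exact h1
    · exact h2
  | algebraMap r => rw [AlgHom.commutes, AlgHom.commutes, Algebra.commutes]
  | add a b _ _ ha hb => rw [map_add, map_add, mul_add, add_mul, ha, hb]
  | mul a b _ _ ha hb => rw [map_mul, map_mul, ← mul_assoc, ha, mul_assoc, hb, mul_assoc]

theorem coshift_mul_sink : coshift F * sink F = 0 := by
  rw [sink_eq, mul_sub, ← mul_assoc, coshift_mul_shift, one_mul, mul_one, sub_self]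

theorem sink_mul_sink : sink F * sink F = sink F := by
  simp [sink, gen_vert_mul_vert]

theorem sink_ne_zero : sink F ≠ 0 := by
  intro h
  have h1 := toMatrix_sink_single 0 (1 : F)
  rw [h, map_zero, LinearMap.zero_apply, if_pos rfl] at h1
  exact Finsupp.single_ne_zero.2 one_ne_zero h1.symm

theorem exists_toMatrix_apply_eq {w : ℕ →₀ F} (hw : w ≠ 0) (v : ℕ →₀ F) :
    ∃ z : Alg F, toMatrix F z w = v := by
  obtain ⟨k, hk⟩ := Finsupp.ne_iff.1 hw
  refine ⟨column k ((w k)⁻¹ • v), ?_⟩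
  rw [toMatrix_column_apply, smul_smul, mul_inv_cancel₀ hk, one_smul]

/-- Every automorphism of the Toeplitz algebra is the conjugation by an invertible matrix. -/
theorem exists_unit_conj (φ : Alg F ≃ₐ[F] Alg F) : ∃ U : (ColFin F)ˣ, ∀ x,
    (U : ColFin F) * toMatrix F x = toMatrix F (φ x) * U := by
  have hQ : toMatrix F (φ (sink F)) ≠ 0 := by
    rw [Ne, map_eq_zero_iff _ toMatrix_injective, map_eq_zero_iff _ φ.injective]
    exact sink_ne_zero
  obtain ⟨v, hv⟩ : ∃ v, toMatrix F (φ (sink F)) v ≠ 0 := by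
    by_contra! h
    exact hQ (LinearMap.ext h)
  set w := toMatrix F (φ (sink F)) v with hw
  -- The vector w lies in the image of an idempotent; it will be the image of e₀.
  have hQw : toMatrix F (φ (sink F)) w = w := by
    rw [hw, ← Module.End.mul_apply, ← map_mul, ← map_mul, sink_mul_sink]
  clear_value w
  have hYX (u) : toMatrix F (φ (coshift F)) (toMatrix F (φ (shift F)) u) = u := by
    rw [← Module.End.mul_apply, ← map_mul, ← map_mul, coshift_mul_shift, map_one, map_one,
      Module.End.one_apply]
  let A : ColFin F := Finsupp.linearCombination F fun i => (toMatrix F (φ (shift F)) ^ i) w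
  have hA (i : ℕ) : A (Finsupp.single i 1) = (toMatrix F (φ (shift F)) ^ i) w := by simp [A]
  have key := comp_toMatrix_eq (A := A) (ψ := (toMatrix F).comp φ.toAlgHom)
    (colFin_ext fun i => by
      rw [Module.End.mul_apply, toMatrix_shift_single, hA, pow_succ', Module.End.mul_apply,
        Module.End.mul_apply, hA]
      rfl)
    (colFin_ext fun i => by
      rcases i with _ | i
      · rw [Module.End.mul_apply, toMatrix_coshift_single_zero, map_zero, Module.End.mul_apply, hA,
          -- Writing w as φ(1 - xy) w shows that φ(y) kills it, because y(1 - xy) = 0.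
          pow_zero, Module.End.one_apply, ← hQw]
        change _ = toMatrix F (φ (coshift F)) _
        rw [← Module.End.mul_apply, ← map_mul, ← map_mul, coshift_mul_sink]
        simp
      · rw [Module.End.mul_apply, toMatrix_coshift_single_succ, Module.End.mul_apply, hA, hA,
          pow_succ', Module.End.mul_apply]
        exact (hYX _).symm)
  replace key (x : Alg F) : A * toMatrix F x = toMatrix F (φ x) * A := key x
  have hA0 : A (Finsupp.single 0 1) = w := by rw [hA, pow_zero, Module.End.one_apply]
  have hbij : Function.Bijective A := by
    constructor
    · rw [injective_iff_map_eq_zero]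
      intro u hu
      ext k
      -- Applying the intertwining relation for e_{0k} to a vector u of the kernel gives u_k w = 0.
      have h1 := LinearMap.congr_fun (key (matUnit 0 k)) u
      rw [Module.End.mul_apply, Module.End.mul_apply, hu, map_zero, toMatrix_matUnit_apply,
        ← mul_one (u k), ← smul_eq_mul, ← Finsupp.smul_single, map_smul, hA0] at h1
      exact (smul_eq_zero.1 h1).resolve_right hv
    · intro u
      -- The algebra acts transitively on nonzero vectors and φ is onto, so every vector is φ(z') w
      -- for some z', which equals A (z' e₀).
      obtain ⟨z, hz⟩ := exists_toMatrix_apply_eq hv u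
      have h1 := LinearMap.congr_fun (key (φ.symm z)) (Finsupp.single 0 1)
      rw [Module.End.mul_apply, Module.End.mul_apply, hA0, AlgEquiv.apply_symm_apply, hz] at h1
      exact ⟨_, h1⟩
  obtain ⟨U, hU⟩ := (Module.End.isUnit_iff A).2 hbij
  exact ⟨U, by rw [hU]; exact key⟩

/-! ### The action on the Laurent polynomials -/

/-- Every homomorphism to a commutative algebra factors through the Laurent polynomials. -/
theorem exists_eq_comp_toLaurent {A : Type*} [CommRing A] [Algebra F A] (ψ : Alg F →ₐ[F] A) :
    ∃ σ : F[T;T⁻¹] →ₐ[F] A, ∀ x, ψ x = σ (toLaurent F x) := by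
  have h : ψ (coshift F) * ψ (shift F) = 1 := by rw [← map_mul, coshift_mul_shift, map_one]
  let u : Aˣ := ⟨ψ (shift F), ψ (coshift F), by rw [mul_comm, h], h⟩
  let σ : F[T;T⁻¹] →ₐ[F] A :=
    AddMonoidAlgebra.lift F A ℤ ((Units.coeHom A).comp (zpowersHom Aˣ u))
  have hσ (n : ℤ) : σ (LaurentPolynomial.T n) = (u ^ n : Aˣ) := by
    simp [σ, LaurentPolynomial.T, -LaurentPolynomial.single_eq_C_mul_T]
  have h1 : ψ = σ.comp (toLaurent F) := by
    apply algHom_ext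
    · rw [AlgHom.comp_apply, toLaurent_shift, hσ]; simp [u]
    · rw [AlgHom.comp_apply, toLaurent_coshift, hσ]; simp [u]
  exact ⟨σ, fun x => by rw [h1]; rfl⟩

theorem C_mul_T_inj {c d : F} {m n : ℤ} (hc : c ≠ 0)
    (h : (LaurentPolynomial.C c * LaurentPolynomial.T m : F[T;T⁻¹]) =
      LaurentPolynomial.C d * LaurentPolynomial.T n) : m = n ∧ c = d := by
  rw [← LaurentPolynomial.smul_eq_C_mul, ← LaurentPolynomial.smul_eq_C_mul] at h
  have h1 := congrArg (fun p : F[T;T⁻¹] => p.coeff m) h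
  have h2 (r : F) (k l : ℤ) : (r • (LaurentPolynomial.T k : F[T;T⁻¹])).coeff l =
      if k = l then r else 0 := by
    change r * (LaurentPolynomial.T k : F[T;T⁻¹]).coeff l = _
    rw [LaurentPolynomial.T_apply, mul_ite, mul_one, mul_zero]
  simp only [h2, if_true] at h1
  split_ifs at h1 with h3
  · exact ⟨h3.symm, h1⟩
  · exact absurd h1 hc

theorem exists_eq_C_mul_T_of_isUnit {p : F[T;T⁻¹]} (hp : IsUnit p) :
    ∃ (c : F) (n : ℤ), c ≠ 0 ∧ p = LaurentPolynomial.C c * LaurentPolynomial.T n := by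
  obtain ⟨q, hq⟩ := hp.exists_right_inv
  obtain ⟨m, P, hP⟩ := p.exists_T_pow
  obtain ⟨n, Q, hQ⟩ := q.exists_T_pow
  have h1 : P * Q = Polynomial.X ^ (m + n) := by
    apply Polynomial.toLaurent_injective
    rw [map_mul, hP, hQ, Polynomial.toLaurent_X_pow, mul_mul_mul_comm, hq, one_mul,
      ← LaurentPolynomial.T_add, Nat.cast_add]
  -- After powers of T clear the denominators, the unit becomes a divisor of a power of the prime X.
  obtain ⟨k, -, hk⟩ := (dvd_prime_pow Polynomial.prime_X (m + n)).1 (Dvd.intro _ h1)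
  obtain ⟨u, hu⟩ := hk.symm
  obtain ⟨c, hc, hcu⟩ := Polynomial.isUnit_iff.1 u.isUnit
  refine ⟨c, k - m, hc.ne_zero, ?_⟩
  have h2 : p = Polynomial.toLaurent P * LaurentPolynomial.T (-m) := by
    rw [hP, LaurentPolynomial.mul_T_assoc, add_neg_cancel, LaurentPolynomial.T_zero, mul_one]
  rw [h2, ← hu, ← hcu, map_mul, Polynomial.toLaurent_X_pow, Polynomial.toLaurent_C,
    LaurentPolynomial.T_sub]
  ring

theorem exists_toLaurent_eq_C_mul_T {u u' : Alg F} (h : u' * u = 1) :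
    ∃ (c : F) (n : ℤ), c ≠ 0 ∧ toLaurent F u = LaurentPolynomial.C c * LaurentPolynomial.T n := by
  apply exists_eq_C_mul_T_of_isUnit
  exact IsUnit.of_mul_eq_one (toLaurent F u') (by rw [mul_comm, ← map_mul, h, map_one])

theorem toMatrix_single_eventually {a : Alg F} {c : F} {n : ℤ}
    (h : toLaurent F a = LaurentPolynomial.C c * LaurentPolynomial.T n) :
    ∀ᶠ j : ℕ in Filter.atTop,
      toMatrix F a (Finsupp.single j 1) = Finsupp.single (j + n).toNat c := by
  have h1 := eventually_toMatrix_eq (a := a) (b := c • shiftZPow n) (by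
    rw [h, map_smul, toLaurent_shiftZPow, LaurentPolynomial.smul_eq_C_mul])
  filter_upwards [h1, Filter.eventually_ge_atTop n.natAbs] with j hj hn
  rw [hj, map_smul, LinearMap.smul_apply, toMatrix_shiftZPow_single, if_pos (by omega)]
  simp

/-! ### The dimension count that bounds degrees of symbols. -/

/-- The span of the first basis vectors. -/
abbrev initialSpan (F : Type*) [Field F] (N : ℕ) : Submodule F (ℕ →₀ F) :=
  Finsupp.supported F F (Set.Iio N)

theorem mem_initialSpan {N : ℕ} {v : ℕ →₀ F} : v ∈ initialSpan F N ↔ ∀ i, N ≤ i → v i = 0 := by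
  rw [Finsupp.mem_supported']
  simp

theorem initialSpan_mono {M N : ℕ} (h : M ≤ N) : initialSpan F M ≤ initialSpan F N :=
  Finsupp.supported_mono (Set.Iio_subset_Iio h)

theorem exists_mem_initialSpan (v : ℕ →₀ F) : ∃ N, v ∈ initialSpan F N := by
  obtain ⟨N, hN⟩ := v.support.finite_toSet.bddAbove
  refine ⟨N + 1, mem_initialSpan.2 fun i hi => ?_⟩
  by_contra h
  have := hN (Finsupp.mem_support_iff.2 h)
  omega

theorem map_mem_of_mem_initialSpan {M : ColFin F} {N : ℕ} {W : Submodule F (ℕ →₀ F)}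
    (h : ∀ j < N, M (Finsupp.single j 1) ∈ W) {v : ℕ →₀ F} (hv : v ∈ initialSpan F N) :
    M v ∈ W := by
  rw [initialSpan, Finsupp.supported_eq_span_single] at hv
  have : Submodule.span F ((fun i => Finsupp.single i (1 : F)) '' Set.Iio N) ≤ W.comap M := by
    rw [Submodule.span_le]
    rintro _ ⟨j, hj, rfl⟩
    exact h j hj
  exact this hv

/-- An injective matrix does not lower the degrees of almost all basis vectors. -/
theorem not_injective_of_eventually_mem {M : ColFin F}
    (h : ∀ᶠ j : ℕ in Filter.atTop, M (Finsupp.single j 1) ∈ initialSpan F j) :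
    ¬ Function.Injective M := by
  intro hM
  obtain ⟨N₀, hN₀⟩ := Filter.eventually_atTop.1 h
  choose f hf using fun j => exists_mem_initialSpan (M (Finsupp.single j 1))
  -- N also bounds the images of the finitely many exceptional basis vectors, so the span of the
  -- first N + 1 basis vectors is mapped into that of the first N.
  obtain ⟨N, hN1, hN2⟩ : ∃ N, N₀ ≤ N ∧ ∀ j < N₀, f j ≤ N :=
    ⟨N₀ + ∑ j ∈ Finset.range N₀, f j, by omega, fun j hj =>
      (Finset.single_le_sum (f := f) (fun _ _ => Nat.zero_le _) (Finset.mem_range.2 hj)).trans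
        (by omega)⟩
  have hmaps (v) (hv : v ∈ initialSpan F (N + 1)) : M v ∈ initialSpan F N := by
    refine map_mem_of_mem_initialSpan (fun j hj => ?_) hv
    rcases lt_or_ge j N₀ with hj' | hj'
    · exact initialSpan_mono (hN2 j hj') (hf j)
    · exact initialSpan_mono (by omega) (hN₀ j hj')
  let R : initialSpan F (N + 1) →ₗ[F] initialSpan F N := M.restrict hmaps
  have hR : Function.Injective R := fun u v huv =>
    Subtype.ext (hM (congrArg Subtype.val huv))
  have hcard := card_le_of_injective' F
    ((Finsupp.supportedEquivFinsupp (Set.Iio N)).toLinearMap ∘ₗ R ∘ₗ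
      (Finsupp.supportedEquivFinsupp (Set.Iio (N + 1))).symm.toLinearMap)
    ((Finsupp.supportedEquivFinsupp (M := F) (R := F) (Set.Iio N)).injective.comp (hR.comp
      (Finsupp.supportedEquivFinsupp (M := F) (R := F) (Set.Iio (N + 1))).symm.injective))
  simp at hcard

theorem nonneg_of_injective {a : Alg F} {c : F} {n : ℤ}
    (h : toLaurent F a = LaurentPolynomial.C c * LaurentPolynomial.T n)
    (ha : Function.Injective (toMatrix F a)) : 0 ≤ n := by
  by_contra hn
  refine not_injective_of_eventually_mem ?_ ha
  -- The condition j ≥ 1 is needed because `toNat` truncates at 0: it ensures that the index of the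
  -- image is below j.
  filter_upwards [toMatrix_single_eventually h, Filter.eventually_ge_atTop 1] with j hj h1
  rw [hj, mem_initialSpan]
  intro i hi
  rw [Finsupp.single_apply, if_neg (by omega)]

theorem injective_of_mul_eq_one {u u' : Alg F} (h : u' * u = 1) :
    Function.Injective (toMatrix F u) := by
  intro v w hvw
  have h1 (v) : toMatrix F u' (toMatrix F u v) = v := by
    rw [← Module.End.mul_apply, ← map_mul, h, map_one, Module.End.one_apply]
  rw [← h1 v, hvw, h1]

/-- The symbols of φ(x) and φ⁻¹(x) are monomials a t^k and b t^m with k, m ≥ 0. Composing the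
induced maps gives t = b a^m t^(mk), so k = m = 1 and b = a⁻¹. -/
theorem exists_toLaurent_apply_shift (φ : Alg F ≃ₐ[F] Alg F) : ∃ a : Fˣ,
    toLaurent F (φ (shift F)) = LaurentPolynomial.C (a : F) * LaurentPolynomial.T 1 ∧
    toLaurent F (φ.symm (shift F)) =
      LaurentPolynomial.C ((a⁻¹ : Fˣ) : F) * LaurentPolynomial.T 1 := by
  have hinv (ψ : Alg F ≃ₐ[F] Alg F) : ψ (coshift F) * ψ (shift F) = 1 := by
    rw [← map_mul, coshift_mul_shift, map_one]
  obtain ⟨a, k, ha, hk⟩ := exists_toLaurent_eq_C_mul_T (hinv φ)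
  obtain ⟨b, m, hb, hm⟩ := exists_toLaurent_eq_C_mul_T (hinv φ.symm)
  have hk0 := nonneg_of_injective hk (injective_of_mul_eq_one (hinv φ))
  have hm0 := nonneg_of_injective hm (injective_of_mul_eq_one (hinv φ.symm))
  obtain ⟨σ, hσ⟩ := exists_eq_comp_toLaurent ((toLaurent F).comp φ.toAlgHom)
  replace hσ (x : Alg F) : toLaurent F (φ x) = σ (toLaurent F x) := hσ x
  obtain ⟨m, rfl⟩ := Int.eq_ofNat_of_zero_le hm0
  have h1 : σ (LaurentPolynomial.T 1) =
      LaurentPolynomial.C a * LaurentPolynomial.T k := by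
    rw [← hk, hσ, toLaurent_shift]
  have h2 : σ (LaurentPolynomial.T m) = LaurentPolynomial.C (a ^ m) * LaurentPolynomial.T (m * k) := by
    rw [show (m : ℤ) = m * 1 by ring, ← LaurentPolynomial.T_pow, map_pow, h1, mul_pow, map_pow,
      LaurentPolynomial.T_pow]
    simp
  have h3 : (LaurentPolynomial.C 1 * LaurentPolynomial.T 1 : F[T;T⁻¹]) =
      LaurentPolynomial.C (b * a ^ m) * LaurentPolynomial.T (m * k) := by
    rw [map_one, one_mul, ← toLaurent_shift, ← φ.apply_symm_apply (shift F), hσ, hm, map_mul, h2,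
      map_mul, mul_assoc]
    congr 1
    exact σ.commutes b
  obtain ⟨h4, h5⟩ := C_mul_T_inj one_ne_zero h3
  have h6 := Int.eq_one_or_neg_one_of_mul_eq_one h4.symm
  obtain rfl : m = 1 := by omega
  obtain rfl : k = 1 := by omega
  refine ⟨Units.mk0 a ha, hk, ?_⟩
  rw [hm, pow_one] at *
  rw [Units.val_inv_eq_inv_val, Units.val_mk0, ← eq_inv_of_mul_eq_one_left h5.symm]
  simp

/-! ### The automorphism group -/

/-- From column N on, the columns are the shifts of column N. Such a matrix agrees up to a finitary
one with b y^N, where b is the polynomial in x whose coefficients form column N. -/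
theorem exists_toMatrix_eq_of_eventually {M : ColFin F}
    (h : ∀ᶠ j : ℕ in Filter.atTop, M (Finsupp.single (j + 1) 1) =
      toMatrix F (shift F) (M (Finsupp.single j 1))) : ∃ u : Alg F, toMatrix F u = M := by
  obtain ⟨N, hN⟩ := Filter.eventually_atTop.1 h
  have h1 (i : ℕ) : M (Finsupp.single (N + i) 1) =
      (toMatrix F (shift F) ^ i) (M (Finsupp.single N 1)) := by
    induction i with
    | zero => simp
    | succ i ih => rw [← add_assoc, hN _ (by omega), ih, pow_succ', Module.End.mul_apply]
  have h2 (q : ℕ →₀ F) : ∃ b : Alg F, ∀ i, toMatrix F b (Finsupp.single i 1) =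
      (toMatrix F (shift F) ^ i) q := by
    induction q using Finsupp.induction_linear with
    | zero => exact ⟨0, by simp⟩
    | add p q hp hq =>
      obtain ⟨a, ha⟩ := hp
      obtain ⟨b, hb⟩ := hq
      exact ⟨a + b, fun i => by rw [map_add, LinearMap.add_apply, ha, hb, map_add]⟩
    | single k r =>
      refine ⟨r • shift F ^ k, fun i => ?_⟩
      rw [map_smul, map_pow, LinearMap.smul_apply, toMatrix_shift_pow_single,
        toMatrix_shift_pow_single, add_comm i k]
      simp
  obtain ⟨b, hb⟩ := h2 (M (Finsupp.single N 1))
  have h3 : IsFinitary (M + (-1 : F) • toMatrix F (b * coshift F ^ N)) := by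
    rw [isFinitary_iff_exists_forall]
    refine ⟨N, fun j hj => ?_⟩
    obtain ⟨i, rfl⟩ := Nat.exists_eq_add_of_le hj
    rw [LinearMap.add_apply, LinearMap.smul_apply, map_mul, map_pow, Module.End.mul_apply,
      toMatrix_coshift_pow_single, if_pos (by omega), Nat.add_sub_cancel_left, hb, h1]
    simp
  obtain ⟨a, -, ha⟩ := h3.exists_toMatrix_eq
  refine ⟨a + b * coshift F ^ N, LinearMap.ext fun v => ?_⟩
  rw [map_add, ha]
  simp

theorem exists_conjUnit (φ : Alg F ≃ₐ[F] Alg F) : ∃ s : GLInf F ⋊[diagAction F] Fˣ,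
    conjAut F s = φ := by
  obtain ⟨U, hU⟩ := exists_unit_conj φ
  have hU' (x : Alg F) : ((U⁻¹ : (ColFin F)ˣ) : ColFin F) * toMatrix F x =
      toMatrix F (φ.symm x) * (U⁻¹ : (ColFin F)ˣ) := by
    rw [Units.inv_mul_eq_iff_eq_mul, ← mul_assoc, Units.eq_mul_inv_iff_mul_eq, hU,
      AlgEquiv.apply_symm_apply]
  obtain ⟨a, ha, ha'⟩ := exists_toLaurent_apply_shift φ
  -- For large j the symbol of φ⁻¹(x) gives U e_{j+1} = a x U e_j; the factor π(a)⁻¹ removes the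
  -- scalar a.
  let M : (ColFin F)ˣ := U * diag F a⁻¹
  have hM : ∃ u, toMatrix F u = M := by
    apply exists_toMatrix_eq_of_eventually
    filter_upwards [toMatrix_single_eventually ha'] with j hj
    have h1 := LinearMap.congr_fun (hU (φ.symm (shift F))) (Finsupp.single j 1)
    rw [AlgEquiv.apply_symm_apply, Module.End.mul_apply, Module.End.mul_apply, hj] at h1
    have h2 : ((j : ℤ) + 1).toNat = j + 1 := by omega
    have h3 (k : ℕ) : (M : ColFin F) (Finsupp.single k 1) =
        ((a⁻¹ : Fˣ) : F) ^ k • (U : ColFin F) (Finsupp.single k 1) := by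
      rw [← map_smul]
      simp [M, diag_single, -map_inv, -Units.val_inv_eq_inv_val]
    rw [h3, h3, map_smul, ← h1, h2, ← map_smul, ← map_smul]
    simp [pow_succ]
  have hM' : ∃ u, toMatrix F u = (M⁻¹ : (ColFin F)ˣ) := by
    apply exists_toMatrix_eq_of_eventually
    filter_upwards [toMatrix_single_eventually ha] with j hj
    have h1 := LinearMap.congr_fun (hU' (φ (shift F))) (Finsupp.single j 1)
    rw [AlgEquiv.symm_apply_apply, Module.End.mul_apply, Module.End.mul_apply, hj] at h1
    have h2 : ((j : ℤ) + 1).toNat = j + 1 := by omega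
    have h3 : M⁻¹ = diag F a * U⁻¹ := by rw [mul_inv_rev, ← map_inv, inv_inv]
    have h4 := LinearMap.congr_fun (diag_mul_shift a)
      (((U⁻¹ : (ColFin F)ˣ) : ColFin F) (Finsupp.single j 1))
    rw [Module.End.mul_apply, LinearMap.smul_apply, Module.End.mul_apply, ← h1, h2] at h4
    rw [h3, Units.val_mul, Module.End.mul_apply, Module.End.mul_apply]
    refine smul_right_injective _ a.ne_zero ?_
    simp only
    rw [← h4, ← map_smul, ← map_smul]
    simp
  obtain ⟨u, hu⟩ := hM
  obtain ⟨u', hu'⟩ := hM'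
  have huu' : u * u' = 1 := toMatrix_injective (by rw [map_mul, hu, hu', Units.mul_inv, map_one])
  have hu'u : u' * u = 1 := toMatrix_injective (by rw [map_mul, hu, hu', Units.inv_mul, map_one])
  obtain ⟨c, n, hc, hn⟩ := exists_toLaurent_eq_C_mul_T hu'u
  obtain ⟨d, m, hd, hm⟩ := exists_toLaurent_eq_C_mul_T huu'
  have hn0 := nonneg_of_injective hn (injective_of_mul_eq_one hu'u)
  have hm0 := nonneg_of_injective hm (injective_of_mul_eq_one huu')
  have h1 : (LaurentPolynomial.C 1 * LaurentPolynomial.T 0 : F[T;T⁻¹]) =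
      LaurentPolynomial.C (c * d) * LaurentPolynomial.T (n + m) := by
    rw [map_mul, LaurentPolynomial.T_add, mul_mul_mul_comm, ← hn, ← hm, ← map_mul, huu']
    simp
  -- The degrees of u and u⁻¹ are nonnegative with sum zero, so both vanish and u has a constant
  -- symbol c.
  have h2 := (C_mul_T_inj one_ne_zero h1).1
  obtain rfl : n = 0 := by omega
  let g : (ColFin F)ˣ := (Units.mk0 c hc)⁻¹ • M
  have hg : g ∈ GLInf F := by
    rw [mem_GLInf_iff]
    filter_upwards [toMatrix_single_eventually hn] with j hj
    rw [hu] at hj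
    have h3 : (g : ColFin F) = c⁻¹ • (M : ColFin F) := rfl
    rw [h3, LinearMap.smul_apply, hj]
    simp [hc]
  refine ⟨⟨⟨g, hg⟩, a⟩, ?_⟩
  ext1 x
  refine toMatrix_injective ?_
  rw [toMatrix_conjAut, Units.mul_inv_eq_iff_eq_mul]
  have h3 : (conjUnit F ⟨⟨g, hg⟩, a⟩ : ColFin F) = c⁻¹ • (U : ColFin F) := by
    have h4 : M * diag F a = U := by simp [M, mul_assoc]
    rw [← h4, Units.val_mul, ← smul_mul_assoc]
    rfl
  rw [h3, smul_mul_assoc, mul_smul_comm, hU]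

end

section

/-! ### Orthonormal bases of symmetric bilinear forms -/

universe u

/-- Over a field in which every element is a square, a nondegenerate symmetric bilinear form which
is not alternating has an orthonormal basis. The characteristic is arbitrary. -/
theorem exists_orthonormal_of_isSquare {K : Type*} [Field K] (hK : ∀ b : K, IsSquare b) (n : ℕ) :
    ∀ {V : Type u} [AddCommGroup V] [Module K V] [FiniteDimensional K V]
      (B : LinearMap.BilinForm K V), B.IsSymm → B.Nondegenerate → Module.finrank K V = n →
      (n ≠ 0 → ∃ v, B v v ≠ 0) →
      ∃ f : Fin n → V, ∀ i j, B (f i) (f j) = if i = j then 1 else 0 := by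
  induction n with
  | zero => exact fun _ _ _ _ _ => ⟨Fin.elim0, fun i => i.elim0⟩
  | succ n ih =>
    intro V _ _ _ B hB hB' hn hv
    have hsymm (x y : V) : B x y = B y x := hB.eq x y
    have horth (x y : V) : y ∈ B.orthogonal (Submodule.span K {x}) ↔ B x y = 0 := by
      rw [LinearMap.BilinForm.mem_orthogonal_iff]
      constructor
      · exact fun h => h x (Submodule.mem_span_singleton_self x)
      · intro h z hz
        obtain ⟨c, rfl⟩ := Submodule.mem_span_singleton.1 hz
        simp [h]
    have hfin (x : V) (hx : B x x = 1) :
        Module.finrank K (B.orthogonal (Submodule.span K {x})) = n := by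
      have h1 : B x x ≠ 0 := by rw [hx]; exact one_ne_zero
      have h2 := Submodule.finrank_add_eq_of_isCompl
        (LinearMap.BilinForm.isCompl_span_singleton_orthogonal h1)
      rw [hn, finrank_span_singleton (by rintro rfl; simp at h1)] at h2
      omega
    have hnd (x : V) (hx : B x x = 1) :
        (B.restrict (B.orthogonal (Submodule.span K {x}))).Nondegenerate :=
      LinearMap.BilinForm.restrict_nondegenerate_orthogonal_spanSingleton B hB' hB.isRefl
        (by rw [hx]; exact one_ne_zero)
    obtain ⟨x, hx, hx'⟩ : ∃ x, B x x = 1 ∧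
        (n ≠ 0 → ∃ v ∈ B.orthogonal (Submodule.span K {x}), B v v ≠ 0) := by
      obtain ⟨v, hv⟩ := hv n.succ_ne_zero
      obtain ⟨s, hs⟩ := hK (B v v)
      have hs0 : s ≠ 0 := by rintro rfl; simp [hs] at hv
      have hx : B (s⁻¹ • v) (s⁻¹ • v) = 1 := by
        simp [hs, hs0]
      generalize s⁻¹ • v = x at hx
      -- The induction can only fail if the form is alternating on the complement of x, which
      -- nondegeneracy allows only in characteristic 2.
      by_cases hgood : n ≠ 0 → ∃ v ∈ B.orthogonal (Submodule.span K {x}), B v v ≠ 0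
      · exact ⟨x, hx, hgood⟩
      push Not at hgood
      obtain ⟨hn0, halt⟩ := hgood
      have : Nontrivial (B.orthogonal (Submodule.span K {x})) :=
        Module.nontrivial_of_finrank_pos (R := K) (by rw [hfin x hx]; omega)
      obtain ⟨u, hu⟩ := exists_ne (0 : B.orthogonal (Submodule.span K {x}))
      obtain ⟨w, hw⟩ : ∃ w : B.orthogonal (Submodule.span K {x}), B u w ≠ 0 := by
        by_contra! h
        exact hu ((hnd x hx).1 u h)
      have h1 : B x u = 0 := (horth x u).1 u.2
      have h2 : B x w = 0 := (horth x w).1 w.2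
      have h3 := halt u u.2
      have h4 := halt w w.2
      -- The vector x + u still has norm 1, and its complement contains x - B(u,w)⁻¹ w, which also
      -- has norm 1.
      refine ⟨x + u, ?_, fun _ => ⟨x - (B u w)⁻¹ • (w : V), ?_, ?_⟩⟩
      · simp [hx, h1, h3, hsymm (u : V) x]
      · rw [horth]
        simp [hx, h1, h2, hsymm (u : V) x, hw]
      · simp [hx, h2, h4, hsymm (w : V) x]
    obtain ⟨f, hf⟩ := ih (B.restrict (B.orthogonal (Submodule.span K {x})))
      ⟨fun y z => hB.eq y z⟩ (hnd x hx) (hfin x hx) (fun h => by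
        obtain ⟨v, hv, hv'⟩ := hx' h
        exact ⟨⟨v, hv⟩, hv'⟩)
    refine ⟨Fin.cons x fun i => (f i : V), fun i j => ?_⟩
    refine Fin.cases ?_ (fun i => ?_) i <;> refine Fin.cases ?_ (fun j => ?_) j
    · simp [hx]
    · simpa [(Fin.succ_ne_zero j).symm] using (horth x (f j)).1 (f j).2
    · rw [hsymm]
      simpa using (horth x (f i)).1 (f i).2
    · simpa using hf i j

theorem exists_transpose_mul_mul_eq_one {K : Type*} [Field K] (hK : ∀ b : K, IsSquare b) {n : ℕ}
    {A : Matrix (Fin n) (Fin n) K} (hA : A.IsSymm) (hA' : IsUnit A) {k : Fin n} (hk : A k k ≠ 0) :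
    ∃ Q : Matrix (Fin n) (Fin n) K, Q.transpose * A * Q = 1 := by
  obtain ⟨f, hf⟩ := exists_orthonormal_of_isSquare hK n (Matrix.toBilin' A)
    ⟨fun v w => by
      simp only [Matrix.toBilin'_apply']
      rw [dotProduct_comm, ← Matrix.vecMul_transpose, hA.eq, Matrix.dotProduct_mulVec]⟩
    (LinearMap.BilinForm.nondegenerate_toBilin'_of_det_ne_zero' A
      ((Matrix.isUnit_iff_isUnit_det A).1 hA').ne_zero) (by simp)
    (fun _ => ⟨Pi.single k 1, by simpa [Matrix.toBilin'_apply'] using hk⟩)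
  refine ⟨Matrix.of fun i j => f j i, ?_⟩
  ext i j
  rw [Matrix.one_apply, ← hf i j, Matrix.toBilin'_apply', Matrix.dotProduct_mulVec]
  rfl

variable {F : Type*} [Field F]

/-! ### Transposes -/

variable (F) in
/-- The standard symmetric bilinear form, for which the basis is orthonormal. -/
def dot : (ℕ →₀ F) →ₗ[F] (ℕ →₀ F) →ₗ[F] F :=
  Finsupp.linearCombination F fun i => Finsupp.lapply i

theorem dot_single_left (i : ℕ) (a : F) (w : ℕ →₀ F) : dot F (Finsupp.single i a) w = a * w i := by
  simp [dot]

theorem dot_single_right (i : ℕ) (a : F) (v : ℕ →₀ F) :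
    dot F v (Finsupp.single i a) = v i * a := by
  induction v using Finsupp.induction_linear with
  | zero => simp
  | add v w hv hw => rw [map_add, LinearMap.add_apply, hv, hw, Finsupp.add_apply, add_mul]
  | single k r =>
    rw [dot_single_left, Finsupp.single_apply, Finsupp.single_apply]
    rcases eq_or_ne i k with rfl | h
    · simp
    · simp [h, h.symm]

/-- The matrices `S` and `T` are the transposes of each other. -/
def IsTranspose (S T : ColFin F) : Prop := ∀ v w, dot F (S v) w = dot F v (T w)

theorem isTranspose_iff {S T : ColFin F} : IsTranspose S T ↔ ∀ i j, entry S i j = entry T j i := by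
  constructor
  · intro h i j
    have := h (Finsupp.single j 1) (Finsupp.single i 1)
    rwa [dot_single_left, dot_single_right, one_mul, mul_one] at this
  · intro h v w
    induction v using Finsupp.induction_linear with
    | zero => simp
    | add v v' hv hv' =>
      rw [map_add, map_add, map_add, LinearMap.add_apply, LinearMap.add_apply, hv, hv']
    | single j a =>
      induction w using Finsupp.induction_linear with
      | zero => simp
      | add w w' hw hw' => rw [map_add, map_add, map_add, hw, hw']
      | single i b =>
        have h1 := h i j
        rw [entry, entry] at h1
        rw [← mul_one a, ← mul_one b, ← smul_eq_mul, ← smul_eq_mul, ← Finsupp.smul_single,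
          ← Finsupp.smul_single]
        simp only [map_smul, LinearMap.smul_apply, dot_single_left, dot_single_right, one_mul,
          mul_one, h1]

theorem IsTranspose.symm {S T : ColFin F} (h : IsTranspose S T) : IsTranspose T S :=
  isTranspose_iff.2 fun i j => (isTranspose_iff.1 h j i).symm

theorem IsTranspose.unique {S T T' : ColFin F} (h : IsTranspose S T) (h' : IsTranspose S T') :
    T = T' := by
  refine colFin_ext fun j => Finsupp.ext fun i => ?_
  exact (isTranspose_iff.1 h j i).symm.trans (isTranspose_iff.1 h' j i)

theorem IsTranspose.mul {S T S' T' : ColFin F} (h : IsTranspose S T) (h' : IsTranspose S' T') :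
    IsTranspose (S * S') (T' * T) := fun v w => by
  rw [Module.End.mul_apply, Module.End.mul_apply, h, h']

theorem IsTranspose.add {S T S' T' : ColFin F} (h : IsTranspose S T) (h' : IsTranspose S' T') :
    IsTranspose (S + S') (T + T') := fun v w => by
  simp only [LinearMap.add_apply, map_add, h v w, h' v w]

theorem isTranspose_one : IsTranspose (1 : ColFin F) 1 := fun _ _ => rfl

theorem IsTranspose.smul {S T : ColFin F} (h : IsTranspose S T) (r : F) :
    IsTranspose (r • S) (r • T) := fun v w => by
  simp only [LinearMap.smul_apply, map_smul, h v w]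

theorem isTranspose_diag (α : Fˣ) : IsTranspose (diag F α : ColFin F) (diag F α) :=
  isTranspose_iff.2 fun i j => by
    rw [entry, entry, diag_single, diag_single, Finsupp.single_apply, Finsupp.single_apply]
    rcases eq_or_ne i j with rfl | h
    · rfl
    · rw [if_neg h, if_neg h.symm]

theorem isTranspose_shift : IsTranspose (toMatrix F (shift F)) (toMatrix F (coshift F)) :=
  isTranspose_iff.2 fun i j => by
    rw [entry, entry, toMatrix_shift_single]
    rcases i with _ | i
    · rw [toMatrix_coshift_single_zero]; simp
    · rw [toMatrix_coshift_single_succ, Finsupp.single_apply, Finsupp.single_apply]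
      simp only [Nat.add_right_cancel_iff, eq_comm]

theorem stdInvolution_gen (g : Gen (Fin 2) (Fin 2)) :
    stdInvolution F graph (gen F graph g) = gen F graph (starGen g) := by
  change (starHom F graph (gen F graph g)).unop = _
  rw [starHom_gen, MulOpposite.unop_op]

theorem stdInvolution_shift : stdInvolution F graph (shift F) = coshift F := by
  rw [shift, map_add, stdInvolution_gen, stdInvolution_gen]; rfl

theorem stdInvolution_coshift : stdInvolution F graph (coshift F) = shift F := by
  rw [coshift, map_add, stdInvolution_gen, stdInvolution_gen]; rfl

end

/-! ### Involutions of an arbitrary algebra. -/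

section
variable {F A : Type*} [Field F] [Ring A] [Algebra F A] (τ : AlgInvolution F A)

theorem involution_mul (a b : A) : τ (a * b) = τ b * τ a := τ.map_mul_rev a b

theorem involution_involution (a : A) : τ (τ a) = a := τ.apply_apply a

theorem involution_one : τ (1 : A) = 1 := by
  have h := involution_mul τ 1 (τ 1)
  rwa [one_mul, involution_involution, one_mul, eq_comm] at h

/-- The composition of two involutions is an automorphism. -/
def involutionComp (σ : AlgInvolution F A) : A ≃ₐ[F] A :=
  AlgEquiv.ofLinearEquiv
    { σ.toLinearMap ∘ₗ τ.toLinearMap with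
      invFun := fun a => τ (σ a)
      left_inv := fun a => by
        change τ (σ (σ (τ a))) = a
        rw [involution_involution, involution_involution]
      right_inv := fun a => by
        change σ (τ (τ (σ a))) = a
        rw [involution_involution, involution_involution] }
    (by change σ (τ 1) = 1; rw [involution_one, involution_one])
    (fun a b => by
      change σ (τ (a * b)) = σ (τ a) * σ (τ b)
      rw [involution_mul, involution_mul])

theorem involutionComp_apply (σ : AlgInvolution F A) (a : A) : involutionComp τ σ a = σ (τ a) := rfl

end

section
variable {F : Type*} [Field F]

theorem isTranspose_stdInvolution (x : Alg F) :
    IsTranspose (toMatrix F x) (toMatrix F (stdInvolution F graph x)) := by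
  have hx : x ∈ Algebra.adjoin F {shift F, coshift F} := by rw [adjoin_shift]; trivial
  induction hx using Algebra.adjoin_induction with
  | mem x h =>
    rcases h with rfl | rfl
    · rw [stdInvolution_shift]; exact isTranspose_shift
    · rw [stdInvolution_coshift]; exact isTranspose_shift.symm
  | algebraMap r =>
    rw [Algebra.algebraMap_eq_smul_one, map_smul, map_smul, map_smul, involution_one, map_one]
    exact isTranspose_one.smul r
  | add a b _ _ ha hb => rw [map_add, map_add, map_add]; exact ha.add hb
  | mul a b _ _ ha hb => rw [involution_mul, map_mul, map_mul]; exact ha.mul hb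

/-! ### Block diagonal matrices -/

/-- The matrix with a finite block `Q` followed by the diagonal entries `f`. -/
def blockEnd {N : ℕ} (Q : Matrix (Fin N) (Fin N) F) (f : ℕ → F) : ColFin F :=
  Finsupp.linearCombination F fun j =>
    if h : j < N then ∑ i : Fin N, Finsupp.single (i : ℕ) (Q i ⟨j, h⟩) else Finsupp.single j (f j)

theorem blockEnd_single_fin {N : ℕ} (Q : Matrix (Fin N) (Fin N) F) (f : ℕ → F) (j : Fin N) (a : F) :
    blockEnd Q f (Finsupp.single j a) = ∑ i : Fin N, Finsupp.single (i : ℕ) (a * Q i j) := by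
  simp [blockEnd, Finset.smul_sum]

theorem blockEnd_single_of_le {N : ℕ} (Q : Matrix (Fin N) (Fin N) F) (f : ℕ → F) {j : ℕ}
    (hj : N ≤ j) (a : F) : blockEnd Q f (Finsupp.single j a) = Finsupp.single j (a * f j) := by
  simp [blockEnd, hj]

theorem blockEnd_ext {N : ℕ} {S T : ColFin F}
    (h1 : ∀ j : Fin N, S (Finsupp.single j 1) = T (Finsupp.single j 1))
    (h2 : ∀ j, N ≤ j → S (Finsupp.single j 1) = T (Finsupp.single j 1)) : S = T :=
  colFin_ext fun j => (lt_or_ge j N).elim (fun h => h1 ⟨j, h⟩) (h2 j)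

theorem blockEnd_mul {N : ℕ} (Q Q' : Matrix (Fin N) (Fin N) F) (f f' : ℕ → F) :
    blockEnd (Q * Q') (f * f') = blockEnd Q f * blockEnd Q' f' := by
  refine blockEnd_ext (N := N) (fun j => ?_) fun j hj => ?_
  · rw [Module.End.mul_apply, blockEnd_single_fin, blockEnd_single_fin, map_sum]
    simp only [blockEnd_single_fin, one_mul, Matrix.mul_apply]
    rw [Finset.sum_comm]
    refine Finset.sum_congr rfl fun i _ => ?_
    rw [← Finsupp.single_finsetSum]
    congr 1
    exact Finset.sum_congr rfl fun k _ => mul_comm _ _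
  · simp only [Module.End.mul_apply, blockEnd_single_of_le _ _ hj, one_mul, Pi.mul_apply]
    rw [mul_comm]

theorem blockEnd_one (N : ℕ) : blockEnd (1 : Matrix (Fin N) (Fin N) F) 1 = 1 := by
  refine blockEnd_ext (N := N) (fun j => ?_) fun j hj => ?_
  · rw [blockEnd_single_fin, Finset.sum_eq_single j]
    · simp
    · intro i _ hij
      rw [Matrix.one_apply_ne hij, mul_zero, Finsupp.single_zero]
    · simp
  · simp [blockEnd_single_of_le _ _ hj]

theorem entry_blockEnd_fin {N : ℕ} (Q : Matrix (Fin N) (Fin N) F) (f : ℕ → F) (i j : Fin N) :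
    entry (blockEnd Q f) i j = Q i j := by
  rw [entry, blockEnd_single_fin, Finsupp.finsetSum_apply, Finset.sum_eq_single i]
  · simp
  · intro k _ hk
    rw [Finsupp.single_apply, if_neg (fun h => hk (Fin.ext h))]
  · simp

theorem entry_blockEnd_fin_of_le {N : ℕ} (Q : Matrix (Fin N) (Fin N) F) (f : ℕ → F) {i : ℕ}
    (hi : N ≤ i) (j : Fin N) : entry (blockEnd Q f) i j = 0 := by
  rw [entry, blockEnd_single_fin, Finsupp.finsetSum_apply]
  refine Finset.sum_eq_zero fun k _ => ?_
  rw [Finsupp.single_apply, if_neg (by omega)]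

theorem entry_blockEnd_of_le {N : ℕ} (Q : Matrix (Fin N) (Fin N) F) (f : ℕ → F) (i : ℕ) {j : ℕ}
    (hj : N ≤ j) : entry (blockEnd Q f) i j = if j = i then f j else 0 := by
  rw [entry, blockEnd_single_of_le _ _ hj, Finsupp.single_apply, one_mul]

theorem isTranspose_blockEnd {N : ℕ} (Q : Matrix (Fin N) (Fin N) F) (f : ℕ → F) :
    IsTranspose (blockEnd Q f) (blockEnd Q.transpose f) := by
  refine isTranspose_iff.2 fun i j => ?_
  rcases lt_or_ge i N with hi | hi <;> rcases lt_or_ge j N with hj | hj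
  · exact (entry_blockEnd_fin Q f ⟨i, hi⟩ ⟨j, hj⟩).trans
      (entry_blockEnd_fin Q.transpose f ⟨j, hj⟩ ⟨i, hi⟩).symm
  · rw [entry_blockEnd_of_le _ _ _ hj, if_neg (by omega)]
    exact (entry_blockEnd_fin_of_le Q.transpose f hj ⟨i, hi⟩).symm
  · rw [entry_blockEnd_of_le _ _ _ hi, if_neg (by omega)]
    exact entry_blockEnd_fin_of_le Q f hi ⟨j, hj⟩
  · rw [entry_blockEnd_of_le _ _ _ hi, entry_blockEnd_of_le _ _ _ hj]
    rcases eq_or_ne i j with rfl | h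
    · rfl
    · rw [if_neg h, if_neg h.symm]

theorem blockEnd_injective {N : ℕ} {Q Q' : Matrix (Fin N) (Fin N) F} {f f' : ℕ → F}
    (h : blockEnd Q f = blockEnd Q' f') : Q = Q' := by
  ext i j
  rw [← entry_blockEnd_fin Q f, h, entry_blockEnd_fin]

/-- A symmetric matrix which is diagonal from some column on is block diagonal. -/
theorem IsTranspose.eq_blockEnd {T : ColFin F} (hT : IsTranspose T T) {N : ℕ} {f : ℕ → F}
    (h : ∀ j, N ≤ j → T (Finsupp.single j 1) = Finsupp.single j (f j)) :
    T = blockEnd (Matrix.of fun i j : Fin N => entry T i j) f := by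
  refine blockEnd_ext (N := N) (fun j => ?_) fun j hj => ?_
  · ext i
    change entry T i j = entry (blockEnd _ f) i j
    rcases lt_or_ge i N with hi | hi
    · exact (entry_blockEnd_fin (Matrix.of fun i j : Fin N => entry T i j) f ⟨i, hi⟩ j).symm
    · rw [entry_blockEnd_fin_of_le _ _ hi, isTranspose_iff.1 hT, entry, h i hi,
        Finsupp.single_apply, if_neg (by omega)]
  · rw [h j hj, blockEnd_single_of_le _ _ hj, one_mul]

end

section
variable {F : Type*} [Field F]

/-! ### Involutions -/

/-- Column-finite matrices need not have a transpose in E; here g lies in the image of the algebra,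
where * supplies one. -/
theorem exists_isTranspose_conjUnit (s : GLInf F ⋊[diagAction F] Fˣ) :
    ∃ V : ColFin F, IsTranspose (conjUnit F s : ColFin F) V := by
  obtain ⟨u, -, hu⟩ := exists_toMatrix_eq_of_mem_GLInf s.left.2
  refine ⟨diag F s.right * toMatrix F (stdInvolution F graph u), ?_⟩
  have h : (conjUnit F s : ColFin F) = toMatrix F u * diag F s.right := by rw [hu]; rfl
  rw [h]
  exact (isTranspose_stdInvolution u).mul (isTranspose_diag _)

/-- If an involution is the composition of conjugation with a matrix and the standard involution,
then this matrix is symmetric. -/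
theorem isTranspose_conjUnit_self (τ : AlgInvolution F (Alg F)) {s : GLInf F ⋊[diagAction F] Fˣ}
    (hs : conjAut F s = involutionComp τ (stdInvolution F graph)) :
    IsTranspose (conjUnit F s : ColFin F) (conjUnit F s) := by
  obtain ⟨V, hV⟩ := exists_isTranspose_conjUnit s
  have hU (x : Alg F) : (conjUnit F s : ColFin F) * toMatrix F x =
      toMatrix F (stdInvolution F graph (τ x)) * conjUnit F s := by
    rw [← involutionComp_apply, ← hs, toMatrix_conjAut, mul_assoc, Units.inv_mul, mul_one]
  have hV' (x : Alg F) : toMatrix F (stdInvolution F graph x) * V = V * toMatrix F (τ x) := by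
    have h1 := hV.mul (isTranspose_stdInvolution x)
    have h2 := (isTranspose_stdInvolution (stdInvolution F graph (τ x))).mul hV
    rw [involution_involution, ← hU] at h2
    exact h1.unique h2
  -- The transpose V satisfies the same intertwining relation as U, so V = rU.
  obtain ⟨r, hr⟩ := exists_eq_smul_one
    (A := (((conjUnit F s)⁻¹ : (ColFin F)ˣ) : ColFin F) * V) (fun x => by
      have h1 := hV' (τ x)
      rw [involution_involution] at h1
      rw [mul_assoc, ← h1, ← mul_assoc, ← mul_assoc]
      congr 1
      rw [Units.inv_mul_eq_iff_eq_mul, ← mul_assoc, Units.eq_mul_inv_iff_mul_eq, ← hU])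
  rw [Units.inv_mul_eq_iff_eq_mul, mul_smul_comm, mul_one] at hr
  obtain ⟨N, hN⟩ := Filter.eventually_atTop.1 (conjUnit_single_eventually s)
  -- U and V share the diagonal entry α^N ≠ 0, which rules out every scalar but r = 1, in particular
  -- the skew-symmetric case.
  have h1 := isTranspose_iff.1 hV N N
  rw [hr, entry, entry, LinearMap.smul_apply, hN N le_rfl, Finsupp.smul_apply,
    Finsupp.single_eq_same, smul_eq_mul] at h1
  have h2 : r = 1 :=
    (mul_right_cancel₀ (pow_ne_zero N s.right.ne_zero) (by rw [one_mul, ← h1]))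
  rw [h2, one_smul] at hr
  rwa [hr] at hV

theorem isTranspose_inv {U : (ColFin F)ˣ} (h : IsTranspose (U : ColFin F) U) :
    IsTranspose ((U⁻¹ : (ColFin F)ˣ) : ColFin F) (U⁻¹ : (ColFin F)ˣ) := fun v w => by
  have h1 (u : ℕ →₀ F) : (U : ColFin F) (((U⁻¹ : (ColFin F)ˣ) : ColFin F) u) = u := by
    rw [← Module.End.mul_apply, Units.mul_inv, Module.End.one_apply]
  conv_lhs => rw [← h1 w]
  rw [← h, h1]

theorem exists_congruent_one (hF : ∀ b : F, IsSquare b) {s : GLInf F ⋊[diagAction F] Fˣ}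
    (hs : IsTranspose (conjUnit F s : ColFin F) (conjUnit F s)) :
    ∃ (t : GLInf F ⋊[diagAction F] Fˣ) (V : ColFin F),
      IsTranspose (conjUnit F t : ColFin F) V ∧ V * conjUnit F s * conjUnit F t = 1 := by
  obtain ⟨N, hN⟩ := Filter.eventually_atTop.1 (conjUnit_single_eventually s)
  set α := s.right with hα
  set U := conjUnit F s with hU
  obtain ⟨b, hb⟩ := hF (α : F)
  have hb0 : b ≠ 0 := by rintro rfl; simp at hb
  have hN' (j : ℕ) (hj : N ≤ j) : ((U⁻¹ : (ColFin F)ˣ) : ColFin F) (Finsupp.single j 1) =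
      Finsupp.single j (((α : F)⁻¹) ^ j) := by
    have h1 : (Finsupp.single j 1 : ℕ →₀ F) =
        (U : ColFin F) (Finsupp.single j (((α : F)⁻¹) ^ j)) := by
      rw [← mul_one (((α : F)⁻¹) ^ j), ← smul_eq_mul, ← Finsupp.smul_single, map_smul, hN j hj,
        Finsupp.smul_single, smul_eq_mul, ← mul_pow, inv_mul_cancel₀ α.ne_zero, one_pow]
    conv_lhs => rw [h1]
    rw [← Module.End.mul_apply, Units.inv_mul, Module.End.one_apply]
  -- The block has size N + 1 rather than N so that it contains the diagonal entry α^N ≠ 0, which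
  -- makes its form non-alternating.
  have hA := hs.eq_blockEnd (N := N + 1) (f := fun j => (α : F) ^ j) fun j hj => hN j (by omega)
  have hA' := (isTranspose_inv hs).eq_blockEnd (N := N + 1) (f := fun j => (α : F)⁻¹ ^ j)
    fun j hj => hN' j (by omega)
  set A : Matrix (Fin (N + 1)) (Fin (N + 1)) F := Matrix.of fun i j => entry (U : ColFin F) i j
  set A' : Matrix (Fin (N + 1)) (Fin (N + 1)) F :=
    Matrix.of fun i j => entry ((U⁻¹ : (ColFin F)ˣ) : ColFin F) i j
  have hAA' : A * A' = 1 := by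
    refine blockEnd_injective (f := (fun j => (α : F) ^ j) * fun j => (α : F)⁻¹ ^ j) (f' := 1) ?_
    rw [blockEnd_mul, ← hA, ← hA', Units.mul_inv, blockEnd_one]
  obtain ⟨Q, hQ⟩ := exists_transpose_mul_mul_eq_one hF (A := A) (k := Fin.last N)
    (Matrix.ext fun i j => isTranspose_iff.1 hs j i)
    (IsUnit.of_mul_eq_one A' hAA')
    (by
      change entry (U : ColFin F) N N ≠ 0
      rw [entry, hN N le_rfl, Finsupp.single_eq_same]
      exact pow_ne_zero N α.ne_zero)
  have hQ' : Q * (Q.transpose * A) = 1 := mul_eq_one_comm.1 hQ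
  have hpow (j : ℕ) : b⁻¹ ^ j * (α : F) ^ j * b⁻¹ ^ j = 1 := by
    rw [hb, ← mul_pow, ← mul_pow]
    field_simp
    simp
  have hf1 : (fun j => b⁻¹ ^ j) * (fun j => (α : F) ^ j) * (fun j => b⁻¹ ^ j) = (1 : ℕ → F) :=
    funext hpow
  have hf2 : (fun j => b⁻¹ ^ j) * ((fun j => b⁻¹ ^ j) * (fun j => (α : F) ^ j)) = (1 : ℕ → F) := by
    rw [mul_comm, hf1]
  -- With Qᵀ A Q = 1 and b² = α, the matrix R made of Q and the entries b^(-j) satisfies Rᵀ U R = 1,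
  -- so RᵀU is its inverse.
  let R : (ColFin F)ˣ :=
    ⟨blockEnd Q fun j => b⁻¹ ^ j,
      blockEnd Q.transpose (fun j => b⁻¹ ^ j) * (U : ColFin F),
      by rw [hA, ← blockEnd_mul, ← blockEnd_mul, hQ', hf2, blockEnd_one],
      by rw [hA, ← blockEnd_mul, ← blockEnd_mul, hQ, hf1, blockEnd_one]⟩
  let β : Fˣ := Units.mk0 b hb0
  have hg : R * diag F β ∈ GLInf F := by
    rw [mem_GLInf_iff]
    filter_upwards [Filter.eventually_ge_atTop (N + 1)] with j hj
    rw [Units.val_mul, Module.End.mul_apply, diag_single, mul_one]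
    change blockEnd Q _ _ = _
    rw [blockEnd_single_of_le _ _ hj, Units.val_mk0, ← mul_pow, mul_inv_cancel₀ hb0, one_pow]
  have hR : conjUnit F ⟨⟨_, hg⟩, β⁻¹⟩ = R := by
    rw [conjUnit_mk, map_inv, mul_inv_cancel_right]
  refine ⟨⟨⟨_, hg⟩, β⁻¹⟩, blockEnd Q.transpose fun j => b⁻¹ ^ j, ?_, ?_⟩
  · rw [hR]
    exact isTranspose_blockEnd Q _
  · rw [hR]
    exact R.inv_mul

theorem exists_algEquiv_involution (hF : ∀ b : F, IsSquare b) (τ : AlgInvolution F (Alg F)) :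
    ∃ φ : Alg F ≃ₐ[F] Alg F, ∀ x, φ (τ x) = stdInvolution F graph (φ x) := by
  obtain ⟨s, hs⟩ := exists_conjUnit (involutionComp τ (stdInvolution F graph))
  have hU := isTranspose_conjUnit_self τ hs
  obtain ⟨t, V, hV, h1⟩ := exists_congruent_one hF hU
  set U := conjUnit F s with hUdef
  set R := conjUnit F t with hRdef
  have hR : ((R⁻¹ : (ColFin F)ˣ) : ColFin F) = V * U := by
    rw [← mul_one (V * (U : ColFin F)), ← Units.mul_inv R, ← mul_assoc, h1, one_mul]
  -- Since R⁻¹ = VU, both U R z R⁻¹ U⁻¹ and the transpose of R z^* R⁻¹ equal U R z V. So conjugation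
  -- by R carries * to τ, and its inverse is the isomorphism sought.
  have key (z : Alg F) : stdInvolution F graph (τ (conjAut F t z)) =
      stdInvolution F graph (conjAut F t (stdInvolution F graph z)) := by
    refine toMatrix_injective ?_
    rw [← involutionComp_apply, ← hs, toMatrix_conjAut, toMatrix_conjAut]
    have h2 : IsTranspose (toMatrix F (conjAut F t (stdInvolution F graph z)))
        (U * R * toMatrix F z * V) := by
      rw [toMatrix_conjAut, hR]
      have h3 := isTranspose_stdInvolution (stdInvolution F graph z)
      rw [involution_involution] at h3
      have h4 := (hV.mul h3).mul (hV.symm.mul hU)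
      simpa only [mul_assoc] using h4
    rw [(isTranspose_stdInvolution _).unique h2, ← hUdef, ← hRdef, Units.mul_inv_eq_iff_eq_mul, hR]
    simp only [mul_assoc]
  refine ⟨(conjAut F t).symm, fun x => ?_⟩
  obtain ⟨z, rfl⟩ := (conjAut F t).surjective x
  have h2 := congrArg (stdInvolution F graph) (key z)
  rw [involution_involution, involution_involution] at h2
  rw [h2, AlgEquiv.symm_apply_apply, AlgEquiv.symm_apply_apply]

/-! ### Automorphisms and the Laurent polynomials -/

theorem exists_laurentEquiv (φ : Alg F ≃ₐ[F] Alg F) :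
    ∃ (a : Fˣ) (σ : F[T;T⁻¹] ≃ₐ[F] F[T;T⁻¹]),
      σ (LaurentPolynomial.T 1) = LaurentPolynomial.C (a : F) * LaurentPolynomial.T 1 ∧
      ∀ x : Alg F, toLaurent F (φ x) = σ (toLaurent F x) := by
  obtain ⟨a, ha, -⟩ := exists_toLaurent_apply_shift φ
  obtain ⟨σ, hσ⟩ := exists_eq_comp_toLaurent ((toLaurent F).comp φ.toAlgHom)
  obtain ⟨σ', hσ'⟩ := exists_eq_comp_toLaurent ((toLaurent F).comp φ.symm.toAlgHom)
  replace hσ (x : Alg F) : toLaurent F (φ x) = σ (toLaurent F x) := hσ x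
  replace hσ' (x : Alg F) : toLaurent F (φ.symm x) = σ' (toLaurent F x) := hσ' x
  refine ⟨a, AlgEquiv.ofAlgHom σ σ' (AlgHom.ext fun p => ?_) (AlgHom.ext fun p => ?_), ?_, hσ⟩
  · obtain ⟨x, rfl⟩ := toLaurent_surjective p
    simp [← hσ, ← hσ']
  · obtain ⟨x, rfl⟩ := toLaurent_surjective p
    simp [← hσ, ← hσ']
  · rw [← ha, hσ, toLaurent_shift]; rfl

theorem exists_eq_smul_one_add_of_conj {φ : Alg F ≃ₐ[F] Alg F} {T : (ColFin F)ˣ}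
    (hφ : ∀ x, φ x - x ∈ sinkIdeal F)
    (hT : ∀ x, toMatrix F (φ x) =
      ((T⁻¹ : (ColFin F)ˣ) : ColFin F) * toMatrix F x * (T : ColFin F)) :
    ∃ (α : F) (a : ColFin F), α ≠ 0 ∧ IsFinitary a ∧
      (T : ColFin F) = α • (1 : ColFin F) + a := by
  obtain ⟨s, rfl⟩ := exists_conjUnit φ
  have hU (x : Alg F) : (conjUnit F s : ColFin F) * toMatrix F x =
      toMatrix F (conjAut F s x) * conjUnit F s := by
    rw [toMatrix_conjAut, mul_assoc, Units.inv_mul, mul_one]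
  have hs : s.right = 1 := by
    have h1 : toLaurent F (conjAut F s (shift F)) = toLaurent F (shift F) := by
      rw [← sub_eq_zero, ← map_sub]
      exact mem_sinkIdeal_iff.1 (hφ _)
    obtain ⟨N, hN⟩ := Filter.eventually_atTop.1
      ((eventually_toMatrix_eq h1).and (conjUnit_single_eventually s))
    obtain ⟨h2, h3⟩ := hN N le_rfl
    obtain ⟨-, h4⟩ := hN (N + 1) (by omega)
    -- In the far column N the relation reads α^(N+1) e_{N+1} = α^N e_{N+1}, because φ(x) and x
    -- agree there.
    have h5 := LinearMap.congr_fun (hU (shift F)) (Finsupp.single N 1)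
    rw [Module.End.mul_apply, Module.End.mul_apply, h3, toMatrix_shift_single, h4,
      ← mul_one ((s.right : F) ^ N), ← smul_eq_mul, ← Finsupp.smul_single, map_smul, h2,
      toMatrix_shift_single, Finsupp.smul_single, smul_eq_mul] at h5
    ext
    exact mul_left_cancel₀ (pow_ne_zero N s.right.ne_zero)
      (by simpa [pow_succ] using Finsupp.single_injective (N + 1) h5)
  -- T and the inverse of the matrix of φ induce the same conjugation, so they differ by a scalar.
  obtain ⟨r, hr⟩ := exists_eq_smul_one (A := (T : ColFin F) * (conjUnit F s : ColFin F)) (fun x => by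
    rw [mul_assoc, hU, hT]
    simp only [← mul_assoc, Units.mul_inv, one_mul])
  have hTr : (T : ColFin F) = r • ((conjUnit F s⁻¹ : (ColFin F)ˣ) : ColFin F) := by
    rw [map_inv, ← mul_one (T : ColFin F), ← Units.mul_inv (conjUnit F s), ← mul_assoc, hr,
      smul_mul_assoc, one_mul]
  obtain ⟨a, ha, hga⟩ := (s⁻¹).left.2
  have hinv : (conjUnit F s⁻¹ : (ColFin F)ˣ) = (s⁻¹).left := by
    change ((s⁻¹).left : (ColFin F)ˣ) * diag F (s⁻¹).right = _
    rw [SemidirectProduct.inv_right, hs, inv_one, map_one, mul_one]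
  refine ⟨r, r • a, ?_, ha.smul r, by rw [hTr, hinv, hga, smul_add]⟩
  rintro rfl
  have h1 := Units.mul_inv T
  rw [hTr, zero_smul, zero_mul] at h1
  exact Finsupp.single_ne_zero.2 (one_ne_zero (α := F))
    (LinearMap.congr_fun h1 (Finsupp.single 0 1)).symm

end

end Toeplitz

end

theorem theorem3 (F : Type*) [Field F] :
    -- the matrix realization of `L(Γ₁)` is faithful, and `L(Γ₁) / I₀ ≅ F[t⁻¹, t]`
    (Function.Injective (Toeplitz.toMatrix F) ∧
      Function.Surjective (Toeplitz.toLaurent F) ∧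
      TwoSidedIdeal.ker (Toeplitz.toLaurent F) = Toeplitz.sinkIdeal F) ∧
    -- `Aut L(Γ₁) ≅ F^* ⋉ GL_∞(F)`, where `(g, α)` acts as conjugation by `g π(α)`
    (∃ Φ : (Toeplitz.GLInf F) ⋊[Toeplitz.diagAction F] Fˣ ≃* (Toeplitz.Alg F ≃ₐ[F] Toeplitz.Alg F),
      ∀ (g : Toeplitz.GLInf F) (α : Fˣ) (x : Toeplitz.Alg F),
        Toeplitz.toMatrix F (Φ ⟨g, α⟩ x) =
          (((g : (Toeplitz.ColFin F)ˣ) * Toeplitz.diag F α : (Toeplitz.ColFin F)ˣ) :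
              Toeplitz.ColFin F) *
            Toeplitz.toMatrix F x *
          ((((g : (Toeplitz.ColFin F)ˣ) * Toeplitz.diag F α)⁻¹ : (Toeplitz.ColFin F)ˣ) :
              Toeplitz.ColFin F)) ∧
    -- every automorphism induces an automorphism `t ↦ a t` of `L(Γ₁) / I₀ ≅ F[t⁻¹, t]`
    (∀ φ : Toeplitz.Alg F ≃ₐ[F] Toeplitz.Alg F,
      ∃ (a : Fˣ) (σ : F[T;T⁻¹] ≃ₐ[F] F[T;T⁻¹]),
        σ (LaurentPolynomial.T 1) = LaurentPolynomial.C (a : F) * LaurentPolynomial.T 1 ∧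
        ∀ x : Toeplitz.Alg F, Toeplitz.toLaurent F (φ x) = σ (Toeplitz.toLaurent F x)) ∧
    -- automorphisms that are the identity modulo `I₀` are conjugations by `α 1 + a` only
    (∀ (φ : Toeplitz.Alg F ≃ₐ[F] Toeplitz.Alg F) (T : (Toeplitz.ColFin F)ˣ),
      (∀ x : Toeplitz.Alg F, φ x - x ∈ Toeplitz.sinkIdeal F) →
      (∀ x : Toeplitz.Alg F, Toeplitz.toMatrix F (φ x) =
        ((T⁻¹ : (Toeplitz.ColFin F)ˣ) : Toeplitz.ColFin F) * Toeplitz.toMatrix F x *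
          (T : Toeplitz.ColFin F)) →
      ∃ (α : F) (a : Toeplitz.ColFin F), α ≠ 0 ∧ Toeplitz.IsFinitary a ∧
        (T : Toeplitz.ColFin F) = α • (1 : Toeplitz.ColFin F) + a) ∧
    -- if every element is a square, every involution is isomorphic to the standard one
    ((∀ b : F, IsSquare b) →
      ∀ τ : AlgInvolution F (Toeplitz.Alg F),
        ∃ φ : Toeplitz.Alg F ≃ₐ[F] Toeplitz.Alg F,
          ∀ x : Toeplitz.Alg F,
            φ (τ x) = Leavitt.stdInvolution F Toeplitz.graph (φ x)) := by
  refine ⟨⟨Toeplitz.toMatrix_injective, Toeplitz.toLaurent_surjective, Toeplitz.ker_toLaurent⟩,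
    ⟨MulEquiv.ofBijective (Toeplitz.conjAut F)
      ⟨Toeplitz.conjAut_injective, fun φ => Toeplitz.exists_conjUnit φ⟩,
      fun g α x => Toeplitz.toMatrix_conjAut ⟨g, α⟩ x⟩,
    Toeplitz.exists_laurentEquiv,
    fun φ T hφ hT => Toeplitz.exists_eq_smul_one_add_of_conj hφ hT,
    Toeplitz.exists_algEquiv_involution⟩
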